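/- All graphs are finite and simple. A graph $G$ is *nice* if no connected component of $G$ is isomorphic to $K_2$. For positive integers $k,l$, a graph $G=(V,E)$ is *$(k,l)$-weight choosable* if, for every assignment of a list $L_v$ of $k$ real numbers to each vertex $v$ and of a list $L_e$ of $l$ real numbers to each edge $e$, there is a total weighting $w : V \cup E \to \mathbb{R}$ with $w(v) \in L_v$ for all $v\in V$ and $w(e) \in L_e$ for all $e\in E$, such that the map $v \mapsto w(v) + \sum_{e \ni v} w(e)$ takes different values on any two adjacent vertices. For a graph $H$ having two vertices at distance exactly $2$, let $\delta_2(H)$ be the minimum of $d_H(u)+d_H(v)$ over all pairs of vertices $u,v$ at distance exactly $2$ in $H$. Let $\partial_2(G)$ be the maximum of $\delta_2(H)$ over all induced subgraphs $H$ of $G$ that have two vertices at distance exactly $2$; if there is no such $H$, put $\partial_2(G) = 2\Delta(G)$, where $\Delta(G)$ is the maximum degree of $G$. **Corollary.** Every nice graph $G$ is $(1, \partial_2(G)+1)$-weight choosable. -/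

import Mathlib

namespace SimpleGraph

variable {V : Type*}

/-- A graph is nice if none of its connected components is isomorphic to `K₂`. -/
def IsNice (G : SimpleGraph V) : Prop :=
  ∀ c : G.ConnectedComponent, IsEmpty (c.toSimpleGraph ≃g completeGraph (Fin 2))

/-- Some two vertices of `G` are at distance exactly `t`. -/
def HasPairAtDist (G : SimpleGraph V) (t : ℕ) : Prop :=
  ∃ u v : V, G.edist u v = (t : ℕ∞)

open Classical in
/-- `δ_t(G)`: the minimum of `d(u) + d(v)` over the pairs of vertices `u`, `v` at distance
exactly `t`. It is used only for graphs that have such a pair. -/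
noncomputable def minDegreeSumAtDist [Fintype V] (G : SimpleGraph V) (t : ℕ) : ℕ :=
  sInf {n : ℕ | ∃ u v : V, G.edist u v = (t : ℕ∞) ∧ n = G.degree u + G.degree v}

open Classical in
/-- The `t`-degeneracy `∂_t(G)`: the maximum of `δ_t(H)` over the induced subgraphs `H` of `G`
that have two vertices at distance exactly `t`; if there is no such `H`, then `∂_t(G) = 2 Δ(G)`. -/
noncomputable def tDegeneracy [Fintype V] (G : SimpleGraph V) (t : ℕ) : ℕ :=
  if ∃ s : Finset V, (G.induce (s : Set V)).HasPairAtDist t then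
    (Finset.univ.filter fun s : Finset V => (G.induce (s : Set V)).HasPairAtDist t).sup
      fun s => (G.induce (s : Set V)).minDegreeSumAtDist t
  else 2 * G.maxDegree

open Classical in
/-- The colour of `v` under the total weighting with vertex weights `wV` and edge weights `wE`:
the weight of `v` plus the weights of the edges incident with `v`. -/
noncomputable def totalWeightSum [Fintype V] (G : SimpleGraph V)
    (wV : V → ℝ) (wE : G.edgeSet → ℝ) (v : V) : ℝ :=
  wV v + ∑ e ∈ Finset.univ.filter (fun e : G.edgeSet => v ∈ e.val), wE e

/-- The total weighting `(wV, wE)` is a vertex colouring by sums: adjacent vertices receive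
different colours. -/
def IsVertexColouringBySums [Fintype V] (G : SimpleGraph V)
    (wV : V → ℝ) (wE : G.edgeSet → ℝ) : Prop :=
  ∀ u v : V, G.Adj u v → G.totalWeightSum wV wE u ≠ G.totalWeightSum wV wE v

/-- `G` is `(k, l)`-weight choosable: for every assignment of lists of `k` real numbers to the
vertices and of `l` real numbers to the edges, one can choose weights from the lists that form a
vertex colouring by sums. -/
def IsWeightChoosable [Fintype V] (G : SimpleGraph V) (k l : ℕ) : Prop :=
  ∀ (LV : V → Finset ℝ) (LE : G.edgeSet → Finset ℝ),
    (∀ v, (LV v).card = k) → (∀ e, (LE e).card = l) →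
    ∃ (wV : V → ℝ) (wE : G.edgeSet → ℝ),
      (∀ v, wV v ∈ LV v) ∧ (∀ e, wE e ∈ LE e) ∧ G.IsVertexColouringBySums wV wE

end SimpleGraph

/-!
The proof is by the polynomial method. Index variables by unordered pairs of vertices, and let
`S v` be the sum of the variables of the edges at `v`. A choice of edge weights colours `G` by sums
when the product over the edges `uv` of `(w u + S u) - (w v + S v)` does not vanish, `w` being the
given vertex weights. By the combinatorial Nullstellensatz it is enough that the product of the
forms `S u - S v`, which is its part of top degree, contains a monomial with all exponents at most
`m = ∂₂(G)` (`HasMonomialLE`, `isWeightChoosable_of_hasMonomialLE`).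

Such a monomial is found by induction over induced subgraphs. Restrict rows (edges) and columns
(variables) of the coefficient matrix of the forms. If a vector `τ`, supported on unused columns
`T`, is annihilated by the rows in `R₂` and by none of the at most `m` remaining rows, then
substituting `τ c * t` for the variables `c` in `T` shows that a good monomial for `R₂` extends to
one for all rows, the columns in `T` being used once per remaining row
(`HasMonomialLE.formProd_of_direction`).

If the current induced subgraph has two vertices at distance two, take such `u`, `v` with
`d(u) + d(v) ≤ m` and a common neighbour `w`. The direction `uw - vw` contributes `1` to `S u`, `-1`
to `S v` and cancels in `S w`, hence removes exactly the rows at `u` and `v`. Deleting `u` and `v`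
can create components `K₂`, whose row has no column left inside the smaller graph. The induction
therefore ignores such rows (`nonisolatedEdges`), and they are removed separately along an edge
joining them to `u` or `v`. The only case where no edge other than `uw` and `vw` is available is a
component `wy`; then the columns `uw` and `vw` are used one after the other, on
`d(u) + 1 ≤ d(u) + d(v)` and `d(v)` rows (`hasMonomialLE_nonisolatedEdges_of_cherry`).

If no two vertices are at distance two, all components are complete, and exponents at most two
suffice for every complete graph other than `K₂` (`hasMonomialLE_cliquePairs`): `K₄` is treated
directly, and the others are built from `K₁` or `K₄` by adding two adjacent vertices `u`, `v` at a
time, using the directions `uz - vz` for all old vertices `z` and the column `uv`. With `s` the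
sum of the variables of the former directions and `X` the variable of the latter, the new rows
contribute `2 * s * (X + s) ^ k * (X - s) ^ k` up to sign, in which
`X ^ 2 * s ^ (2 * k - 1)` has a nonzero coefficient.
-/

namespace MvPolynomial

variable {σ ρ : Type*}

/-! ### Monomials with small exponents -/

/-- Some monomial occurring in `P` has all its exponents at most `m`. -/
def HasMonomialLE (m : ℕ) (P : MvPolynomial σ ℝ) : Prop :=
  ∃ β ∈ P.support, ∀ c, β c ≤ m

/-- The substitution `X c ↦ a c * X (g c) * t ^ k c`. It sends monomials to scalar multiples of
monomials. -/
noncomputable def gradedSubst (a : σ → ℝ) (g : σ → σ) (k : σ → ℕ) :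
    MvPolynomial σ ℝ →ₐ[ℝ] Polynomial (MvPolynomial σ ℝ) :=
  aeval fun c => Polynomial.C (C (a c) * X (g c)) * Polynomial.X ^ k c

theorem gradedSubst_monomial (a : σ → ℝ) (g : σ → σ) (k : σ → ℕ) (β : σ →₀ ℕ) (b : ℝ) :
    gradedSubst a g k (monomial β b) =
      Polynomial.C (monomial (β.mapDomain g) (b * β.prod fun c n => a c ^ n)) *
        Polynomial.X ^ (β.sum fun c n => k c * n) := by
  classical
  rw [gradedSubst, aeval_monomial]
  induction β using Finsupp.induction with
  | zero => simp [Polynomial.algebraMap_apply, algebraMap_eq]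
  | single_add c n β hc hn ih =>
    have hd : Disjoint (Finsupp.single c n).support β.support := by
      exact Finset.disjoint_of_subset_left Finsupp.support_single_subset (by simpa using hc)
    rw [Finsupp.prod_add_index_of_disjoint hd, Finsupp.prod_add_index_of_disjoint hd,
      Finsupp.sum_add_index_of_disjoint hd, mul_left_comm, ih, Finsupp.mapDomain_add]
    rw [Finsupp.prod_single_index (by simp), Finsupp.prod_single_index (by simp),
      Finsupp.sum_single_index (by simp), Finsupp.mapDomain_single]
    have : monomial (Finsupp.single (g c) n + Finsupp.mapDomain g β)
        (b * (a c ^ n * β.prod fun c n => a c ^ n)) =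
        (C (a c) * X (g c)) ^ n * monomial (Finsupp.mapDomain g β)
          (b * β.prod fun c n => a c ^ n) := by
      rw [mul_pow, ← C_pow, X_pow_eq_monomial, C_mul_monomial, monomial_mul]
      congr 1; ring
    rw [this, mul_pow, ← pow_mul, pow_add]
    simp only [map_mul, map_pow]
    ring

theorem exists_mem_support_of_coeff_gradedSubst {a : σ → ℝ} {g : σ → σ} {k : σ → ℕ} {d : ℕ}
    {P : MvPolynomial σ ℝ} {γ : σ →₀ ℕ} (h : γ ∈ ((gradedSubst a g k P).coeff d).support) :
    ∃ β ∈ P.support, β.mapDomain g = γ ∧ (β.sum fun c n => k c * n) = d := by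
  classical
  rw [mem_support_iff, P.as_sum, map_sum, Polynomial.finsetSum_coeff, coeff_sum] at h
  obtain ⟨β, hβ, hne⟩ := Finset.exists_ne_zero_of_sum_ne_zero h
  refine ⟨β, hβ, ?_⟩
  rw [gradedSubst_monomial, Polynomial.coeff_C_mul, Polynomial.coeff_X_pow] at hne
  split_ifs at hne with hd
  · rw [mul_one, coeff_monomial] at hne
    split_ifs at hne with hg
    · exact ⟨hg, hd.symm⟩
    · exact absurd rfl hne
  · simp at hne

/-- Monomials with small exponents can be pulled back along a graded substitution: the exponent of a
variable does not decrease when it is identified with others. -/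
theorem HasMonomialLE.of_coeff_gradedSubst {m : ℕ} (a : σ → ℝ) (g : σ → σ) (k : σ → ℕ) (d : ℕ)
    {P : MvPolynomial σ ℝ} (h : HasMonomialLE m ((gradedSubst a g k P).coeff d)) :
    HasMonomialLE m P := by
  classical
  obtain ⟨γ, hγ, hm⟩ := h
  obtain ⟨β, hβ, rfl, -⟩ := exists_mem_support_of_coeff_gradedSubst hγ
  refine ⟨β, hβ, fun c => le_trans ?_ (hm (g c))⟩
  rw [Finsupp.mapDomain, Finsupp.sum, Finsupp.finsetSum_apply]
  by_cases hc : c ∈ β.support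
  · refine le_trans ?_ (Finset.single_le_sum (f := fun i => Finsupp.single (g i) (β i) (g c))
      (fun _ _ => Nat.zero_le _) hc)
    simp
  · simp [Finsupp.notMem_support_iff.1 hc]

theorem HasMonomialLE.one (m : ℕ) : HasMonomialLE m (1 : MvPolynomial σ ℝ) :=
  ⟨0, by simp, by simp⟩

theorem HasMonomialLE.smul {m : ℕ} {P : MvPolynomial σ ℝ} (h : HasMonomialLE m P) {r : ℝ}
    (hr : r ≠ 0) : HasMonomialLE m (C r * P) := by
  obtain ⟨β, hβ, hm⟩ := h
  refine ⟨β, ?_, hm⟩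
  rw [mem_support_iff, coeff_C_mul] at *
  exact mul_ne_zero hr hβ

theorem HasMonomialLE.mono {m n : ℕ} {P : MvPolynomial σ ℝ} (h : HasMonomialLE m P)
    (hmn : m ≤ n) : HasMonomialLE n P :=
  h.imp fun _ hβ => ⟨hβ.1, fun c => (hβ.2 c).trans hmn⟩

/-- In a product of polynomials in disjoint sets of variables no two terms can cancel. -/
theorem HasMonomialLE.mul {m : ℕ} {P Q : MvPolynomial σ ℝ} {S T : Set σ} (hST : Disjoint S T)
    (hPS : P ∈ supported ℝ S) (hQT : Q ∈ supported ℝ T)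
    (hP : HasMonomialLE m P) (hQ : HasMonomialLE m Q) : HasMonomialLE m (P * Q) := by
  classical
  obtain ⟨α, hα, hαm⟩ := hP
  obtain ⟨β, hβ, hβm⟩ := hQ
  have key : ∀ {U : Set σ} {F : MvPolynomial σ ℝ}, F ∈ supported ℝ U → ∀ γ ∈ F.support,
      ∀ c ∉ U, γ c = 0 := by
    intro U F hF γ hγ c hc
    by_contra h0
    exact hc (mem_supported.1 hF (mem_vars_iff_mem_support c |>.2 ⟨γ, hγ, Finsupp.mem_support_iff.2 h0⟩))
  have hdis : ∀ c, c ∉ S ∨ c ∉ T := fun c => by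
    by_contra! h
    exact Set.disjoint_left.1 hST h.1 h.2
  refine ⟨α + β, ?_, fun c => ?_⟩
  · rw [mem_support_iff, coeff_mul, Finset.sum_eq_single (α, β)]
    · exact mul_ne_zero (mem_support_iff.1 hα) (mem_support_iff.1 hβ)
    · rintro ⟨x, y⟩ hxy hne
      by_contra h0
      have hx := mem_support_iff.2 (left_ne_zero_of_mul h0)
      have hy := mem_support_iff.2 (right_ne_zero_of_mul h0)
      have hs : x + y = α + β := by simpa using hxy
      have hc : ∀ c, x c = α c ∧ y c = β c := by
        intro c
        have hsc : x c + y c = α c + β c := DFunLike.congr_fun hs c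
        rcases hdis c with h | h
        · rw [key hPS x hx c h, key hPS α hα c h] at *; simpa using hsc
        · rw [key hQT y hy c h, key hQT β hβ c h] at *; simpa using hsc
      exact hne (Prod.ext (Finsupp.ext fun c => (hc c).1) (Finsupp.ext fun c => (hc c).2))
    · intro h; exact absurd (by simp) h
  · rcases hdis c with h | h
    · simpa [key hPS α hα c h] using hβm c
    · simpa [key hQT β hβ c h] using hαm c

theorem HasMonomialLE.X_pow {m d : ℕ} (hd : d ≤ m) (i : σ) :
    HasMonomialLE m (X i ^ d : MvPolynomial σ ℝ) := by
  classical
  refine ⟨Finsupp.single i d, by simp [X_pow_eq_monomial, mem_support_iff], fun c => ?_⟩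
  rw [Finsupp.single_apply]; split_ifs <;> omega

/-! ### Products of linear forms -/

/-- A product of linear forms: the rows of the coefficient matrix `L` in `R`, with only the
variables in `D` kept. -/
noncomputable def formProd (L : ρ → σ → ℝ) (R : Finset ρ) (D : Finset σ) : MvPolynomial σ ℝ :=
  ∏ r ∈ R, ∑ c ∈ D, C (L r c) * X c

theorem formProd_mem_supported (L : ρ → σ → ℝ) (R : Finset ρ) (D : Finset σ) :
    formProd L R D ∈ supported ℝ (D : Set σ) :=
  prod_mem fun _ _ => sum_mem fun _ hc =>
    mul_mem (Subalgebra.algebraMap_mem _ _) (X_mem_supported.2 (Finset.mem_coe.2 hc))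

/-- Elimination of the rows outside `R₂`: they are the only ones that survive the substitution
`X c ↦ a c * X (g c)` on the variables in `T`, so that the part of highest degree in these
variables splits off. -/
theorem HasMonomialLE.formProd_of_subst {m : ℕ} {L : ρ → σ → ℝ} {R R₂ : Finset ρ}
    {T D D' : Finset σ} [DecidableEq ρ] (a : σ → ℝ) (g : σ → σ) (hR : R₂ ⊆ R) (hT : T ⊆ D')
    (hD : D ⊆ D') (hTD : Disjoint T D)
    (h0 : ∀ r ∈ R₂, ∑ c ∈ T, C (a c * L r c) * X (g c) = (0 : MvPolynomial σ ℝ))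
    (h : HasMonomialLE m
      ((∏ r ∈ R \ R₂, ∑ c ∈ T, C (a c * L r c) * X (g c)) * formProd L R₂ D)) :
    HasMonomialLE m (formProd L R D') := by
  classical
  let a' : σ → ℝ := fun c => if c ∈ T then a c else if c ∈ D then 1 else 0
  let g' : σ → σ := fun c => if c ∈ T then g c else c
  let k : σ → ℕ := fun c => if c ∈ T then 1 else 0
  have hrow : ∀ r, gradedSubst a' g' k (∑ c ∈ D', C (L r c) * X c) =
      Polynomial.C (∑ c ∈ T, C (a c * L r c) * X (g c)) * Polynomial.X +
        Polynomial.C (∑ c ∈ D, C (L r c) * X c) := by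
    intro r
    have hsub : T ∪ D ⊆ D' := Finset.union_subset hT hD
    rw [map_sum, ← Finset.sum_subset hsub, Finset.sum_union hTD, map_sum, map_sum,
      Finset.sum_mul]
    · congr 1
      · refine Finset.sum_congr rfl fun c hc => ?_
        simp only [gradedSubst, map_mul, aeval_X, algHom_C, a', g', k, hc, if_true, pow_one,
          Polynomial.algebraMap_apply, algebraMap_eq]
        ring
      · refine Finset.sum_congr rfl fun c hc => ?_
        have hcT : c ∉ T := Finset.disjoint_right.1 hTD hc
        simp [gradedSubst, map_mul, aeval_X, algHom_C, a', g', k, hc, hcT,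
          Polynomial.algebraMap_apply, algebraMap_eq]
    · intro c _ hc
      rw [Finset.mem_union, not_or] at hc
      simp [gradedSubst, a', hc.1, hc.2]
  refine HasMonomialLE.of_coeff_gradedSubst a' g' k ((R \ R₂).card) ?_
  have : (gradedSubst a' g' k (formProd L R D')).coeff ((R \ R₂).card) =
      (∏ r ∈ R \ R₂, ∑ c ∈ T, C (a c * L r c) * X (g c)) * formProd L R₂ D := by
    rw [formProd, map_prod, ← Finset.prod_sdiff hR]
    have h2 : ∏ r ∈ R₂, gradedSubst a' g' k (∑ c ∈ D', C (L r c) * X c) =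
        Polynomial.C (formProd L R₂ D) := by
      rw [formProd, map_prod]
      exact Finset.prod_congr rfl fun r hr => by rw [hrow, h0 r hr]; simp
    rw [h2, Polynomial.coeff_mul_C]
    congr 1
    have h1 := Polynomial.coeff_prod_of_natDegree_le (R \ R₂)
      (fun r => gradedSubst a' g' k (∑ c ∈ D', C (L r c) * X c)) 1 (fun r _ => by
        simp only [hrow]; exact Polynomial.natDegree_linear_le)
    rw [mul_one] at h1
    rw [h1]
    exact Finset.prod_congr rfl fun r _ => by rw [hrow]; simp
  rwa [this]

/-- Peeling off rows along a direction: the vector `τ`, supported on the variables in `T`, is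
annihilated by the rows in `R₂` and by none of the others. -/
theorem HasMonomialLE.formProd_of_direction {m : ℕ} {L : ρ → σ → ℝ} {R R₂ : Finset ρ}
    {T D D' : Finset σ} [DecidableEq ρ] (τ : σ → ℝ) (hT : T.Nonempty) (hR : R₂ ⊆ R)
    (hTD' : T ⊆ D') (hD : D ⊆ D') (hTD : Disjoint T D)
    (h0 : ∀ r ∈ R₂, ∑ c ∈ T, τ c * L r c = 0)
    (h1 : ∀ r ∈ R, r ∉ R₂ → ∑ c ∈ T, τ c * L r c ≠ 0) (hm : (R \ R₂).card ≤ m)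
    (h : HasMonomialLE m (formProd L R₂ D)) : HasMonomialLE m (formProd L R D') := by
  obtain ⟨i, hi⟩ := hT
  have hsum : ∀ r, ∑ c ∈ T, C (τ c * L r c) * X i =
      (C (∑ c ∈ T, τ c * L r c) * X i : MvPolynomial σ ℝ) := fun r => by
    rw [map_sum, Finset.sum_mul]
  refine formProd_of_subst τ (fun _ => i) hR hTD' hD hTD (fun r hr => ?_) ?_
  · rw [hsum, h0 r hr]; simp
  · simp only [hsum]
    rw [Finset.prod_mul_distrib, Finset.prod_const, ← map_prod, mul_assoc]
    refine HasMonomialLE.smul ?_ (Finset.prod_ne_zero_iff.2 fun r hr => ?_)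
    · refine HasMonomialLE.mul (S := {i}) (T := D) ?_ ?_ (formProd_mem_supported _ _ _)
        (HasMonomialLE.X_pow hm i) h
      · simpa using Finset.disjoint_left.1 hTD hi
      · exact pow_mem (X_mem_supported.2 (Set.mem_singleton i)) _
    · rw [Finset.mem_sdiff] at hr
      exact h1 r hr.1 hr.2

/-- Block triangular products: the rows in `R₂` do not involve the variables in `T`. -/
theorem HasMonomialLE.formProd_of_block {m : ℕ} {L : ρ → σ → ℝ} {R R₂ : Finset ρ}
    {T D D' : Finset σ} [DecidableEq ρ] (hR : R₂ ⊆ R) (hTD' : T ⊆ D') (hD : D ⊆ D')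
    (hTD : Disjoint T D) (h0 : ∀ r ∈ R₂, ∀ c ∈ T, L r c = 0)
    (h1 : HasMonomialLE m (formProd L (R \ R₂) T))
    (h2 : HasMonomialLE m (formProd L R₂ D)) : HasMonomialLE m (formProd L R D') := by
  refine formProd_of_subst (fun _ => 1) id hR hTD' hD hTD (fun r hr => ?_) ?_
  · exact Finset.sum_eq_zero fun c hc => by simp [h0 r hr c hc]
  · simp only [one_mul, id]
    exact HasMonomialLE.mul (Finset.disjoint_coe.2 hTD) (formProd_mem_supported _ _ _)
      (formProd_mem_supported _ _ _) h1 h2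

/-! ### Powers of sums of variables -/

theorem sum_X_mem_supported (I : Finset σ) :
    (∑ i ∈ I, X i : MvPolynomial σ ℝ) ∈ supported ℝ (I : Set σ) :=
  sum_mem fun _ hi => X_mem_supported.2 hi

theorem _root_.Polynomial.coeff_linear_pow {A : Type*} [CommRing A] (u v : A) {e : ℕ} (he : e ≠ 0)
    (n j : ℕ) : ((Polynomial.C u * Polynomial.X ^ e + Polynomial.C v) ^ n).coeff (e * j) =
      n.choose j * (u ^ j * v ^ (n - j)) := by
  rw [add_pow, Polynomial.finsetSum_coeff]
  have hterm : ∀ i, ((Polynomial.C u * Polynomial.X ^ e) ^ i * Polynomial.C v ^ (n - i) *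
      (n.choose i : Polynomial A)) =
      Polynomial.C (n.choose i * (u ^ i * v ^ (n - i))) * Polynomial.X ^ (e * i) := fun i => by
    rw [mul_pow, ← pow_mul]; simp only [map_mul, map_pow, map_natCast]; ring
  simp only [hterm, Polynomial.coeff_C_mul_X_pow]
  rw [Finset.sum_eq_single j]
  · simp
  · intro i _ hij
    rw [if_neg]
    intro h
    exact hij (Nat.eq_of_mul_eq_mul_left (Nat.pos_of_ne_zero he) h).symm
  · intro hj
    rw [if_pos rfl, Nat.choose_eq_zero_of_lt (by simpa [Nat.lt_succ_iff] using hj)]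
    simp

/-- The power `(∑ i ∈ I, X i) ^ p` contains every monomial of degree `p` in the variables in `I`;
one of them has exponents at most `m` as soon as `p ≤ m * #I`. -/
theorem HasMonomialLE.sum_X_pow {m : ℕ} (I : Finset σ) {p : ℕ} (hp : p ≤ m * I.card) :
    HasMonomialLE m ((∑ i ∈ I, X i : MvPolynomial σ ℝ) ^ p) := by
  classical
  induction I using Finset.induction_on generalizing p with
  | empty =>
    obtain rfl : p = 0 := by simpa using hp
    simpa using HasMonomialLE.one m
  | insert i I hi ih =>
    rw [Finset.card_insert_of_notMem hi, mul_add, mul_one] at hp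
    -- Extract the coefficient of `X i ^ min p m` from the binomial expansion.
    let k : σ → ℕ := fun c => if c = i then 1 else 0
    refine of_coeff_gradedSubst (fun _ => 1) id k (min p m) ?_
    have h1 : gradedSubst (fun _ => 1) id k (∑ j ∈ I, X j : MvPolynomial σ ℝ) =
        Polynomial.C (∑ j ∈ I, X j) := by
      rw [map_sum, map_sum]
      refine Finset.sum_congr rfl fun j hj => ?_
      have : j ≠ i := fun h => hi (h ▸ hj)
      simp [gradedSubst, k, this]
    have h2 : gradedSubst (fun _ => 1) id k ((∑ j ∈ insert i I, X j : MvPolynomial σ ℝ) ^ p) =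
        (Polynomial.C (X i) * Polynomial.X ^ 1 + Polynomial.C (∑ j ∈ I, X j)) ^ p := by
      rw [map_pow, Finset.sum_insert hi, map_add, h1]
      simp [gradedSubst, k]
    have h3 := Polynomial.coeff_linear_pow (X i : MvPolynomial σ ℝ) (∑ j ∈ I, X j) one_ne_zero p
      (min p m)
    rw [one_mul] at h3
    rw [h2, h3]
    have hc : ((p.choose (min p m) : ℕ) : MvPolynomial σ ℝ) = C ((p.choose (min p m) : ℕ) : ℝ) := by
      simp
    rw [hc]
    refine HasMonomialLE.smul ?_ (Nat.cast_ne_zero.2 (Nat.choose_pos (min_le_left _ _)).ne')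
    refine HasMonomialLE.mul (S := {i}) (T := I) (by simpa using hi)
      (pow_mem (X_mem_supported.2 (Set.mem_singleton i)) _) (pow_mem (sum_X_mem_supported I) _)
      (HasMonomialLE.X_pow (min_le_right _ _) i) (ih (by omega))

/-- Exchanging signs of factors does not affect which monomials occur in a product. -/
theorem HasMonomialLE.prod_of_eq_or_eq_neg {m : ℕ} {R : Finset ρ} {f h : ρ → MvPolynomial σ ℝ}
    {Q : MvPolynomial σ ℝ} (hfh : ∀ r ∈ R, f r = h r ∨ f r = -h r)
    (hh : HasMonomialLE m ((∏ r ∈ R, h r) * Q)) : HasMonomialLE m ((∏ r ∈ R, f r) * Q) := by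
  classical
  have : ∃ ε : ℝ, ε ≠ 0 ∧ ∏ r ∈ R, f r = C ε * ∏ r ∈ R, h r := by
    clear hh
    induction R using Finset.induction_on with
    | empty => exact ⟨1, one_ne_zero, by simp⟩
    | insert r R hr ih =>
      obtain ⟨ε, hε, he⟩ := ih fun r hr => hfh r (Finset.mem_insert_of_mem hr)
      rw [Finset.prod_insert hr, Finset.prod_insert hr, he]
      rcases hfh r (Finset.mem_insert_self _ _) with h | h
      · exact ⟨ε, hε, by rw [h]; ring⟩
      · exact ⟨-ε, neg_ne_zero.2 hε, by rw [h, C_neg]; ring⟩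
  obtain ⟨ε, hε, he⟩ := this
  rw [he, mul_assoc]
  exact hh.smul hε

end MvPolynomial

namespace MvPolynomial

variable {σ : Type*}

/-- The product `(X i + s) ^ k * (X i - s) ^ k * (2 * s)`, where `s` is the sum of `k ≥ 1` further
variables, contributes the nonzero multiple `X i ^ 2 * s ^ (2 * k - 1)` of degree two in `X i`. -/
theorem HasMonomialLE.twin_prod {I : Finset σ} {i : σ} (hi : i ∉ I) (hI : I.Nonempty) :
    HasMonomialLE 2 ((X i + ∑ j ∈ I, X j) ^ I.card * (X i - ∑ j ∈ I, X j) ^ I.card *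
      (2 * ∑ j ∈ I, X j) : MvPolynomial σ ℝ) := by
  classical
  set s : MvPolynomial σ ℝ := ∑ j ∈ I, X j with hs
  obtain ⟨k, hk⟩ : ∃ k, I.card = k + 1 := Nat.exists_eq_succ_of_ne_zero hI.card_ne_zero
  let κ : σ → ℕ := fun c => if c = i then 1 else 0
  refine of_coeff_gradedSubst (fun _ => 1) id κ (2 * 1) ?_
  have h1 : gradedSubst (fun _ => 1) id κ s = Polynomial.C s := by
    rw [hs, map_sum, map_sum]
    refine Finset.sum_congr rfl fun j hj => ?_
    have : j ≠ i := fun h => hi (h ▸ hj)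
    simp [gradedSubst, κ, this]
  have h2 : gradedSubst (fun _ => 1) id κ (X i) = Polynomial.C (X i) * Polynomial.X := by
    simp [gradedSubst, κ]
  have h3 : gradedSubst (fun _ => 1) id κ ((X i + s) ^ I.card * (X i - s) ^ I.card * (2 * s)) =
      (Polynomial.C (X i ^ 2) * Polynomial.X ^ 2 + Polynomial.C (-(s ^ 2))) ^ (k + 1) *
        Polynomial.C (2 * s) := by
    rw [hk, ← mul_pow, map_mul, map_mul, map_pow, map_mul, map_add, map_sub, h1, h2, map_ofNat]
    simp only [map_mul, map_pow, map_neg, map_ofNat]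
    ring
  rw [h3, Polynomial.coeff_mul_C, Polynomial.coeff_linear_pow _ _ two_ne_zero]
  have h4 : (((k + 1).choose 1 : ℕ) : MvPolynomial σ ℝ) *
      ((X i ^ 2) ^ 1 * (-(s ^ 2)) ^ (k + 1 - 1)) * (2 * s) =
      C (2 * ((k : ℝ) + 1) * (-1) ^ k) * (X i ^ 2 * s ^ (2 * k + 1)) := by
    rw [Nat.choose_one_right, Nat.add_sub_cancel, neg_pow]
    simp only [map_mul, map_pow, map_neg, map_one, map_add, map_natCast, map_ofNat]
    push_cast
    ring
  rw [h4]
  refine HasMonomialLE.smul ?_ (mul_ne_zero (by positivity) (pow_ne_zero _ (by norm_num)))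
  refine HasMonomialLE.mul (S := {i}) (T := I) (by simpa using hi)
    (pow_mem (X_mem_supported.2 (Set.mem_singleton i)) _)
    (pow_mem (sum_X_mem_supported I) _) (HasMonomialLE.X_pow le_rfl i)
    (HasMonomialLE.sum_X_pow I (by omega))

end MvPolynomial

namespace SimpleGraph

open MvPolynomial

variable {V : Type*}

/-! ### The rows of pairs of vertices -/

open Classical in
/-- The incidence of the vertex `v` with the pair `c`, as a real number. -/
noncomputable def incidence (v : V) (c : Sym2 V) : ℝ := if v ∈ c then 1 else 0

/-- The row of the pair `e = s(p, q)`: the coefficients, in the variables indexed by pairs of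
vertices, of the difference between the sums of the variables at `p` and at `q`. The order of the
two ends is chosen arbitrarily. -/
noncomputable def pairRow (e c : Sym2 V) : ℝ :=
  incidence (Quot.out e).1 c - incidence (Quot.out e).2 c

theorem pairRow_mk (p q : V) : (∀ c, pairRow s(p, q) c = incidence p c - incidence q c) ∨
    ∀ c, pairRow s(p, q) c = -(incidence p c - incidence q c) := by
  have h : s((Quot.out s(p, q)).1, (Quot.out s(p, q)).2) = s(p, q) := Quot.out_eq _
  rcases Sym2.eq_iff.1 h with ⟨h1, h2⟩ | ⟨h1, h2⟩
  · exact Or.inl fun c => by rw [pairRow, h1, h2]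
  · exact Or.inr fun c => by rw [pairRow, h1, h2]; ring

theorem sum_mul_pairRow_eq_zero_iff (T : Finset (Sym2 V)) (τ : Sym2 V → ℝ) (p q : V) :
    ∑ c ∈ T, τ c * pairRow s(p, q) c = 0 ↔
      ∑ c ∈ T, τ c * incidence p c = ∑ c ∈ T, τ c * incidence q c := by
  rw [← sub_eq_zero (b := ∑ c ∈ T, τ c * incidence q c), ← Finset.sum_sub_distrib]
  rcases pairRow_mk p q with h | h
  · simp only [h, mul_sub]
  · simp only [h, mul_neg, mul_sub, Finset.sum_neg_distrib, neg_eq_zero]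

theorem sum_pairRow_mul_X (T : Finset (Sym2 V)) (a : Sym2 V → ℝ) (g : Sym2 V → Sym2 V) (p q : V)
    {P Q : MvPolynomial (Sym2 V) ℝ} (hP : ∑ c ∈ T, C (a c * incidence p c) * X (g c) = P)
    (hQ : ∑ c ∈ T, C (a c * incidence q c) * X (g c) = Q) :
    ∑ c ∈ T, C (a c * pairRow s(p, q) c) * X (g c) = P - Q ∨
      ∑ c ∈ T, C (a c * pairRow s(p, q) c) * X (g c) = -(P - Q) := by
  rw [← hP, ← hQ, ← Finset.sum_sub_distrib, ← Finset.sum_neg_distrib]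
  rcases pairRow_mk p q with h | h
  · exact Or.inl (Finset.sum_congr rfl fun c _ => by rw [h, mul_sub, map_sub, sub_mul])
  · exact Or.inr (Finset.sum_congr rfl fun c _ => by
      rw [h, mul_neg, mul_sub, map_neg, map_sub]; ring)

/-- Peeling off the rows of the pairs having exactly one end in the pair `c`, along the variable
of `c`. -/
theorem formProd_pairRow_of_single [DecidableEq V] {m : ℕ} {R R₂ D D' : Finset (Sym2 V)}
    (c : Sym2 V) (hR : R₂ ⊆ R) (hc : c ∈ D') (hD : D ⊆ D') (hcD : c ∉ D)
    (h0 : ∀ p q, s(p, q) ∈ R₂ → (p ∈ c ↔ q ∈ c))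
    (h1 : ∀ p q, s(p, q) ∈ R → s(p, q) ∉ R₂ → ¬(p ∈ c ↔ q ∈ c)) (hm : (R \ R₂).card ≤ m)
    (h : HasMonomialLE m (formProd pairRow R₂ D)) : HasMonomialLE m (formProd pairRow R D') := by
  refine HasMonomialLE.formProd_of_direction (T := {c}) (fun _ => 1) (Finset.singleton_nonempty c)
    hR (by simpa using hc) hD (by simpa using hcD) ?_ ?_ hm h
  · refine Sym2.ind fun p q hr => ?_
    rw [sum_mul_pairRow_eq_zero_iff]
    have := h0 p q hr
    rw [Finset.sum_singleton, Finset.sum_singleton]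
    by_cases hp : p ∈ c <;> by_cases hq : q ∈ c <;> simp_all [incidence]
  · refine Sym2.ind fun p q hr hr2 => ?_
    rw [Ne, sum_mul_pairRow_eq_zero_iff]
    have := h1 p q hr hr2
    rw [Finset.sum_singleton, Finset.sum_singleton]
    by_cases hp : p ∈ c <;> by_cases hq : q ∈ c <;> simp_all [incidence]

/-- Peeling off rows along the difference of the variables of `s(u, w)` and `s(v, w)`: this
direction adds `1` at `u`, subtracts `1` at `v` and cancels at the common neighbour `w`. -/
theorem formProd_pairRow_of_cherry [DecidableEq V] {m : ℕ} {R R₂ D D' : Finset (Sym2 V)}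
    {u v w : V} (huv : u ≠ v) (huw : u ≠ w) (hvw : v ≠ w) (hR : R₂ ⊆ R)
    (huc : s(u, w) ∈ D') (hvc : s(v, w) ∈ D') (hD : D ⊆ D') (huD : s(u, w) ∉ D)
    (hvD : s(v, w) ∉ D) (h0 : ∀ e ∈ R₂, u ∉ e ∧ v ∉ e)
    (h1 : ∀ e ∈ R, e ∉ R₂ → ¬e.IsDiag ∧ (u ∈ e ∨ v ∈ e)) (hm : (R \ R₂).card ≤ m)
    (h : HasMonomialLE m (formProd pairRow R₂ D)) : HasMonomialLE m (formProd pairRow R D') := by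
  have hne : s(u, w) ≠ s(v, w) := by simp [huv, huw]
  have hsum : ∀ x, ∑ c ∈ {s(u, w), s(v, w)}, (if c = s(u, w) then 1 else -1) * incidence x c =
      (if x = u then 1 else if x = v then -1 else 0 : ℝ) := by
    intro x
    rw [Finset.sum_pair hne, if_pos rfl, if_neg hne.symm]
    by_cases hxu : x = u
    · subst hxu; simp [incidence, huv, huw]
    · by_cases hxv : x = v
      · subst hxv; simp [incidence, huv.symm, hvw]
      · by_cases hxw : x = w
        · subst hxw; simp [incidence, hxu, hxv]
        · simp [incidence, hxu, hxv, hxw]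
  refine HasMonomialLE.formProd_of_direction (T := {s(u, w), s(v, w)})
    (fun c => if c = s(u, w) then 1 else -1) (by simp) hR ?_ hD ?_ ?_ ?_ hm h
  · simp [Finset.insert_subset_iff, huc, hvc]
  · simp [huD, hvD]
  · refine Sym2.ind fun p q hr => ?_
    rw [sum_mul_pairRow_eq_zero_iff, hsum, hsum]
    have := h0 _ hr
    simp only [Sym2.mem_iff, not_or] at this
    simp [Ne.symm this.1.1, Ne.symm this.1.2, Ne.symm this.2.1, Ne.symm this.2.2]
  · refine Sym2.ind fun p q hr hr2 => ?_
    rw [Ne, sum_mul_pairRow_eq_zero_iff, hsum, hsum]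
    obtain ⟨hd, hmem⟩ := h1 _ hr hr2
    rw [Sym2.mk_isDiag_iff] at hd
    rw [Sym2.mem_iff, Sym2.mem_iff] at hmem
    split_ifs <;> norm_num <;> grind

/-! ### Complete graphs -/

open Classical in
/-- The edges of the complete graph on the vertex set `A`. -/
noncomputable def cliquePairs (A : Finset V) : Finset (Sym2 V) :=
  A.sym2.filter fun e => ¬e.IsDiag

theorem mk_mem_cliquePairs {A : Finset V} {p q : V} :
    s(p, q) ∈ cliquePairs A ↔ (p ∈ A ∧ q ∈ A) ∧ p ≠ q := by
  classical
  simp [cliquePairs]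

/-- The graph `K₄` cannot be built from `K₂`. Here the variables of `s(p, q)` and `s(r, t)` give the
fourth power of their sum on the four edges between `{p, q}` and `{r, t}`, and the variable of
`s(q, r)` takes care of the two remaining rows. -/
theorem hasMonomialLE_cliquePairs_four [DecidableEq V] {p q r t : V} (hpq : p ≠ q) (hpr : p ≠ r)
    (hpt : p ≠ t) (hqr : q ≠ r) (hqt : q ≠ t) (hrt : r ≠ t) :
    HasMonomialLE 2 (formProd pairRow (cliquePairs {p, q, r, t}) (cliquePairs {p, q, r, t})) := by
  have hne : s(p, q) ≠ s(r, t) := by simp [hpr, hpt]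
  -- The opposite signs make both variables enter the rows between the two pairs equally.
  let a : Sym2 V → ℝ := fun c => if c = s(p, q) then 1 else -1
  have hsum : ∀ x, ∑ c ∈ {s(p, q), s(r, t)}, C (a c * incidence x c) * X (id c) =
      C (incidence x s(p, q)) * X s(p, q) - C (incidence x s(r, t)) * X s(r, t) := by
    intro x
    rw [Finset.sum_pair hne]
    simp [a, hne.symm]
    ring
  have hsdiff : cliquePairs {p, q, r, t} \ {s(p, q), s(r, t)} =
      {s(p, r), s(p, t), s(q, r), s(q, t)} := by
    ext e
    induction e using Sym2.ind with | _ x y =>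
    simp only [Finset.mem_sdiff, mk_mem_cliquePairs, Finset.mem_insert, Finset.mem_singleton,
      Sym2.eq_iff]
    grind
  refine HasMonomialLE.formProd_of_subst (R₂ := {s(p, q), s(r, t)}) (T := {s(p, q), s(r, t)})
    (D := {s(q, r)}) a id ?_ ?_ ?_ ?_ ?_ ?_
  · simp [Finset.insert_subset_iff, mk_mem_cliquePairs, hpq, hrt]
  · simp [Finset.insert_subset_iff, mk_mem_cliquePairs, hpq, hrt]
  · simp [mk_mem_cliquePairs, hqr]
  · simp [hrt, hqt, hqr, hpr.symm, hqr.symm]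
  · intro e he
    rw [Finset.mem_insert, Finset.mem_singleton] at he
    rcases he with rfl | rfl
    · rcases sum_pairRow_mul_X {s(p, q), s(r, t)} a id p q (hsum p) (hsum q) with h | h <;>
        rw [h] <;> simp [incidence, hpq, hpr, hpt, hqr, hqt]
    · rcases sum_pairRow_mul_X {s(p, q), s(r, t)} a id r t (hsum r) (hsum t) with h | h <;>
        rw [h] <;> simp [incidence, hpr.symm, hpt.symm, hqr.symm, hqt.symm]
  · refine HasMonomialLE.prod_of_eq_or_eq_neg (h := fun _ => ∑ c ∈ {s(p, q), s(r, t)}, X c) ?_ ?_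
    · intro e he
      rw [hsdiff] at he
      simp only [Finset.mem_insert, Finset.mem_singleton] at he
      have key : ∀ x y, (x = p ∨ x = q) → (y = r ∨ y = t) →
          (∑ c ∈ {s(p, q), s(r, t)}, C (a c * pairRow s(x, y) c) * X (id c) =
            ∑ c ∈ {s(p, q), s(r, t)}, X c ∨
          ∑ c ∈ {s(p, q), s(r, t)}, C (a c * pairRow s(x, y) c) * X (id c) =
            -∑ c ∈ {s(p, q), s(r, t)}, X c) := by
        intro x y hx hy
        have hX : C (incidence x s(p, q)) * X s(p, q) - C (incidence x s(r, t)) * X s(r, t) =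
            (X s(p, q) : MvPolynomial (Sym2 V) ℝ) := by
          rcases hx with rfl | rfl <;> simp [incidence, hpr, hpt, hqr, hqt]
        have hY : C (incidence y s(p, q)) * X s(p, q) - C (incidence y s(r, t)) * X s(r, t) =
            (-X s(r, t) : MvPolynomial (Sym2 V) ℝ) := by
          rcases hy with rfl | rfl <;> simp [incidence, hpr.symm, hpt.symm, hqr.symm, hqt.symm]
        have := sum_pairRow_mul_X {s(p, q), s(r, t)} a id x y ((hsum x).trans hX)
          ((hsum y).trans hY)
        rwa [sub_neg_eq_add, ← Finset.sum_pair hne] at this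
      rcases he with rfl | rfl | rfl | rfl
      exacts [key _ _ (.inl rfl) (.inl rfl), key _ _ (.inl rfl) (.inr rfl),
        key _ _ (.inr rfl) (.inl rfl), key _ _ (.inr rfl) (.inr rfl)]
    · have hcard : (cliquePairs {p, q, r, t} \ {s(p, q), s(r, t)}).card = 4 := by
        rw [hsdiff]
        rw [Finset.card_insert_of_notMem, Finset.card_insert_of_notMem,
          Finset.card_insert_of_notMem, Finset.card_singleton] <;>
          simp <;> grind
      rw [Finset.prod_const, hcard]
      refine HasMonomialLE.mul (S := ({s(p, q), s(r, t)} : Finset (Sym2 V)))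
        (T := ({s(q, r)} : Finset (Sym2 V))) ?_ (pow_mem (sum_X_mem_supported _) _)
        (formProd_mem_supported _ _ _) (HasMonomialLE.sum_X_pow _ ?_) ?_
      · rw [Finset.disjoint_coe]
        simp [hrt, hqt, hqr, hpr.symm, hqr.symm]
      · rw [Finset.card_pair hne]
      · refine formProd_pairRow_of_single s(q, r) (R₂ := ∅) (D := ∅) (by simp) (by simp) (by simp)
          (by simp) (by simp) ?_ ?_ ?_
        · intro x y hxy _
          simp only [Finset.mem_insert, Finset.mem_singleton, Sym2.eq_iff] at hxy
          simp only [Sym2.mem_iff]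
          grind
        · simp [Finset.card_pair hne]
        · simpa [formProd] using HasMonomialLE.one 2

/-- Adding two adjacent vertices `u` and `v` to a complete graph. Along the direction
`s(u, z) - s(v, z)`, for any old vertex `z`, the row of `s(u, z')` takes the value `1`, that of
`s(v, z')` the value `-1` and that of `s(u, v)` the value `2`, up to the sign of the row. -/
theorem hasMonomialLE_cliquePairs_insert_insert [DecidableEq V] {u v : V} {B : Finset V}
    (huv : u ≠ v) (hu : u ∉ B) (hv : v ∉ B) (hB : B.Nonempty)
    (h : HasMonomialLE 2 (formProd pairRow (cliquePairs B) (cliquePairs B))) :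
    HasMonomialLE 2 (formProd pairRow (cliquePairs (insert u (insert v B)))
      (cliquePairs (insert u (insert v B)))) := by
  set A := insert u (insert v B) with hA
  let T₁ : Finset (Sym2 V) := B.image fun z => s(u, z)
  let T₂ : Finset (Sym2 V) := B.image fun z => s(v, z)
  let T : Finset (Sym2 V) := insert s(u, v) (T₁ ∪ T₂)
  let a : Sym2 V → ℝ := fun c => if u ∈ c then 1 else -1
  -- The variables of `s(u, z)` and `s(v, z)` are identified; that of `s(u, v)` becomes the
  -- variable of the diagonal pair `s(u, u)`, which is not used otherwise.
  let g : Sym2 V → Sym2 V := Sym2.map (Function.update id v u)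
  set S : MvPolynomial (Sym2 V) ℝ := ∑ c ∈ T₁, X c with hS
  have hBu : ∀ z ∈ B, z ≠ u := fun z hz h => hu (h ▸ hz)
  have hBv : ∀ z ∈ B, z ≠ v := fun z hz h => hv (h ▸ hz)
  have hsplit : ∀ x, ∑ c ∈ T, C (a c * incidence x c) * X (g c) =
      C (incidence x s(u, v)) * X s(u, u) + (∑ z ∈ B, C (incidence x s(u, z)) * X s(u, z) -
        ∑ z ∈ B, C (incidence x s(v, z)) * X s(u, z)) := by
    intro x
    rw [Finset.sum_insert, Finset.sum_union, Finset.sum_image, Finset.sum_image, sub_eq_add_neg,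
      ← Finset.sum_neg_distrib]
    · congr 1
      · simp [a, g, Function.update_of_ne huv]
      · congr 1
        · refine Finset.sum_congr rfl fun z hz => ?_
          simp [a, g, Function.update_of_ne huv, Function.update_of_ne (hBv z hz)]
        · refine Finset.sum_congr rfl fun z hz => ?_
          have : ¬u ∈ s(v, z) := by simp [huv, (hBu z hz).symm]
          simp only [a, if_neg this]
          simp [g, Function.update_of_ne (hBv z hz)]
    · exact fun x _ y _ hxy => Sym2.congr_right.1 hxy
    · exact fun x _ y _ hxy => Sym2.congr_right.1 hxy
    · simp only [T₁, T₂, Finset.disjoint_left, Finset.mem_image]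
      rintro _ ⟨z, hz, rfl⟩ ⟨y, hy, hyz⟩
      rw [Sym2.eq_iff] at hyz
      grind
    · simp only [T₁, T₂, Finset.mem_union, Finset.mem_image, Sym2.eq_iff]
      grind
  have hSB : S = ∑ z ∈ B, X s(u, z) := by
    rw [hS, Finset.sum_image]
    exact fun x _ y _ hxy => Sym2.congr_right.1 hxy
  have hsumu : ∑ c ∈ T, C (a c * incidence u c) * X (g c) = X s(u, u) + S := by
    rw [hsplit, hSB, Finset.sum_eq_zero (s := B) (f := fun z => C (incidence u s(v, z)) * X s(u, z))
      fun z hz => by simp [incidence, huv, (hBu z hz).symm]]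
    simp [incidence]
  have hsumv : ∑ c ∈ T, C (a c * incidence v c) * X (g c) = X s(u, u) - S := by
    rw [hsplit, hSB, Finset.sum_eq_zero (s := B) (f := fun z => C (incidence v s(u, z)) * X s(u, z))
      fun z hz => by simp [incidence, huv.symm, (hBv z hz).symm]]
    simp [incidence, sub_eq_add_neg]
  have hsumB : ∀ z ∈ B, ∑ c ∈ T, C (a c * incidence z c) * X (g c) = 0 := by
    intro z hz
    rw [hsplit]
    have : ∀ y, incidence z s(u, y) = incidence z s(v, y) := fun y => by
      simp [incidence, hBu z hz, hBv z hz]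
    simp only [this, sub_self]
    simp [incidence, hBv z hz]
  have hTmem : ∀ x y, s(x, y) ∈ T ↔ s(x, y) = s(u, v) ∨ (∃ z ∈ B, s(x, y) = s(u, z)) ∨
      ∃ z ∈ B, s(x, y) = s(v, z) := by
    intro x y
    simp only [T, T₁, T₂, Finset.mem_insert, Finset.mem_union, Finset.mem_image,
      eq_comm (a := s(x, y))]
  have hsdiff : cliquePairs A \ cliquePairs B = T := by
    ext e
    induction e using Sym2.ind with | _ x y =>
    rw [hTmem]
    clear hsplit hsumu hsumv hsumB hTmem
    simp only [hA, Finset.mem_sdiff, mk_mem_cliquePairs, Finset.mem_insert, Sym2.eq_iff]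
    grind
  refine HasMonomialLE.formProd_of_subst (R₂ := cliquePairs B) (T := T) (D := cliquePairs B) a g
    ?_ (hsdiff ▸ Finset.sdiff_subset) ?_ (hsdiff ▸ Finset.sdiff_disjoint) ?_ ?_
  · refine fun e => Sym2.ind (fun x y => ?_) e
    simp only [hA, mk_mem_cliquePairs, Finset.mem_insert]
    tauto
  · refine fun e => Sym2.ind (fun x y => ?_) e
    simp only [hA, mk_mem_cliquePairs, Finset.mem_insert]
    tauto
  · refine Sym2.ind fun x y hxy => ?_
    rw [mk_mem_cliquePairs] at hxy
    rcases sum_pairRow_mul_X T a g x y (hsumB x hxy.1.1) (hsumB y hxy.1.2) with h | h <;>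
      simpa using h
  · rw [hsdiff]
    refine HasMonomialLE.prod_of_eq_or_eq_neg (h := fun e => if e = s(u, v) then 2 * S else
      if e ∈ T₁ then X s(u, u) + S else X s(u, u) - S) ?_ ?_
    · refine Sym2.ind fun x y hxy => ?_
      have huvT : s(u, v) ∉ T₁ := by
        simp only [T₁, Finset.mem_image, Sym2.eq_iff]; grind
      rcases (hTmem x y).1 hxy with h | ⟨z, hz, h⟩ | ⟨z, hz, h⟩
      · rw [h, if_pos rfl]
        have := sum_pairRow_mul_X T a g u v hsumu hsumv
        rwa [show X s(u, u) + S - (X s(u, u) - S) = 2 * S by ring] at this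
      · have h1 : s(u, z) ≠ s(u, v) := fun h => hBv z hz (Sym2.congr_right.1 h)
        have h2 : s(u, z) ∈ T₁ := Finset.mem_image_of_mem _ hz
        rw [h, if_neg h1, if_pos h2]
        have := sum_pairRow_mul_X T a g u z hsumu (hsumB z hz)
        rwa [sub_zero] at this
      · have h1 : s(v, z) ≠ s(u, v) := by
          rw [Ne, Sym2.eq_iff]; grind
        have h2 : s(v, z) ∉ T₁ := by
          simp only [T₁, Finset.mem_image, Sym2.eq_iff]; grind
        rw [h, if_neg h1, if_neg h2]
        have := sum_pairRow_mul_X T a g v z hsumv (hsumB z hz)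
        rwa [sub_zero] at this
    · have hdis : Disjoint T₁ T₂ := by
        simp only [T₁, T₂, Finset.disjoint_left, Finset.mem_image]
        rintro _ ⟨z, hz, rfl⟩ ⟨y, hy, hyz⟩
        rw [Sym2.eq_iff] at hyz
        grind
      have huvT₁ : s(u, v) ∉ T₁ := by
        simp only [T₁, Finset.mem_image, Sym2.eq_iff]; grind
      have huvT₂ : s(u, v) ∉ T₂ := by
        simp only [T₂, Finset.mem_image, Sym2.eq_iff]; grind
      have hc₁ : T₁.card = B.card :=
        Finset.card_image_of_injective _ fun x y hxy => Sym2.congr_right.1 hxy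
      have hc₂ : T₂.card = B.card :=
        Finset.card_image_of_injective _ fun x y hxy => Sym2.congr_right.1 hxy
      have hp₁ : ∏ e ∈ T₁, (if e = s(u, v) then 2 * S else
          if e ∈ T₁ then X s(u, u) + S else X s(u, u) - S) = (X s(u, u) + S) ^ T₁.card := by
        refine Finset.prod_eq_pow_card fun e he => ?_
        rw [if_neg (ne_of_mem_of_not_mem he huvT₁), if_pos he]
      have hp₂ : ∏ e ∈ T₂, (if e = s(u, v) then 2 * S else
          if e ∈ T₁ then X s(u, u) + S else X s(u, u) - S) = (X s(u, u) - S) ^ T₁.card := by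
        rw [hc₁, ← hc₂]
        refine Finset.prod_eq_pow_card fun e he => ?_
        rw [if_neg (ne_of_mem_of_not_mem he huvT₂), if_neg (Finset.disjoint_right.1 hdis he)]
      rw [Finset.prod_insert (by simp [huvT₁, huvT₂]), Finset.prod_union hdis, hp₁, hp₂,
        if_pos rfl, mul_comm (2 * S)]
      have huuT₁ : s(u, u) ∉ T₁ := by
        simp only [T₁, Finset.mem_image, Sym2.eq_iff]; grind
      have hX : X s(u, u) ∈ supported ℝ (insert s(u, u) (T₁ : Set (Sym2 V))) :=
        X_mem_supported.2 (Set.mem_insert _ _)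
      have hS' : S ∈ supported ℝ (insert s(u, u) (T₁ : Set (Sym2 V))) :=
        supported_mono (Set.subset_insert _ _) (sum_X_mem_supported T₁)
      refine HasMonomialLE.mul (S := insert s(u, u) T₁) (T := (cliquePairs B : Set (Sym2 V))) ?_ ?_
        (formProd_mem_supported _ _ _)
        (HasMonomialLE.twin_prod huuT₁ (Finset.image_nonempty.2 hB)) h
      · rw [Set.disjoint_left]
        intro e he heB
        rw [Finset.mem_coe] at heB
        rcases he with rfl | he
        · simp [mk_mem_cliquePairs] at heB
        · obtain ⟨z, hz, rfl⟩ := Finset.mem_image.1 (Finset.mem_coe.1 he)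
          exact hu (mk_mem_cliquePairs.1 heB).1.1
      · have h2S : 2 * S ∈ supported ℝ (insert s(u, u) (T₁ : Set (Sym2 V))) := by
          rw [two_mul]; exact add_mem hS' hS'
        exact mul_mem (mul_mem (pow_mem (add_mem hX hS') _) (pow_mem (sub_mem hX hS') _)) h2S

/-- Every complete graph other than `K₂` has a monomial with exponents at most two. -/
theorem hasMonomialLE_cliquePairs (A : Finset V) (hA : A.card ≠ 2) :
    HasMonomialLE 2 (formProd pairRow (cliquePairs A) (cliquePairs A)) := by
  classical
  induction A using Finset.strongInduction with | _ A ih =>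
  rcases Nat.lt_or_ge A.card 2 with hlt | hge
  · have : cliquePairs A = ∅ := by
      refine Finset.eq_empty_of_forall_notMem fun e => Sym2.ind (fun x y hxy => ?_) e
      rw [mk_mem_cliquePairs] at hxy
      exact hxy.2 (Finset.card_le_one.1 (by omega) x hxy.1.1 y hxy.1.2)
    simpa [this, formProd] using HasMonomialLE.one 2
  by_cases h4 : A.card = 4
  · obtain ⟨p, q, r, t, hpq, hpr, hpt, hqr, hqt, hrt, rfl⟩ := Finset.card_eq_four.1 h4
    exact hasMonomialLE_cliquePairs_four hpq hpr hpt hqr hqt hrt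
  · obtain ⟨u, v, hu, hv, huv⟩ := Finset.one_lt_card_iff.1 (show 1 < A.card by omega)
    obtain ⟨A₁, hA₁, rfl⟩ : ∃ A₁, u ∉ A₁ ∧ insert u A₁ = A :=
      ⟨A.erase u, Finset.notMem_erase _ _, Finset.insert_erase hu⟩
    obtain ⟨B, hB, rfl⟩ : ∃ B, v ∉ B ∧ insert v B = A₁ :=
      ⟨A₁.erase v, Finset.notMem_erase _ _, Finset.insert_erase (by
        simpa [huv.symm] using hv)⟩
    have huB : u ∉ B := fun h => hA₁ (Finset.mem_insert_of_mem h)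
    rw [Finset.card_insert_of_notMem hA₁, Finset.card_insert_of_notMem hB] at *
    refine hasMonomialLE_cliquePairs_insert_insert huv huB hB ?_ (ih B ?_ ?_)
    · rw [← Finset.card_pos]; omega
    · exact (Finset.ssubset_insert hB).trans (Finset.ssubset_insert hA₁)
    · omega

end SimpleGraph

namespace SimpleGraph

open MvPolynomial

variable {V : Type*}

/-! ### The induction over induced subgraphs -/

open Classical in
/-- The edges of the subgraph of `G` induced by `s`. -/
noncomputable def inducedEdges [Fintype V] (G : SimpleGraph V) (s : Finset V) :
    Finset (Sym2 V) :=
  G.edgeFinset.filter fun e => ∀ x ∈ e, x ∈ s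

open Classical in
/-- The edges of the subgraph of `G` induced by `s` that do not form a component `K₂` of it. -/
noncomputable def nonisolatedEdges [Fintype V] (G : SimpleGraph V) (s : Finset V) :
    Finset (Sym2 V) :=
  (G.inducedEdges s).filter fun e => ∃ x ∈ e, ∃ z ∈ s, z ∉ e ∧ G.Adj x z

open Classical in
/-- The degree of `v` in the subgraph of `G` induced by `s`. -/
noncomputable def inducedDegree (G : SimpleGraph V) (s : Finset V) (v : V) : ℕ :=
  (s.filter fun z => G.Adj v z).card

section

variable [Fintype V] {G : SimpleGraph V} {s t : Finset V}

theorem mem_inducedEdges {e : Sym2 V} :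
    e ∈ G.inducedEdges s ↔ e ∈ G.edgeSet ∧ ∀ x ∈ e, x ∈ s := by
  simp [inducedEdges]

theorem mk_mem_inducedEdges {p q : V} :
    s(p, q) ∈ G.inducedEdges s ↔ G.Adj p q ∧ p ∈ s ∧ q ∈ s := by
  simp [inducedEdges]

theorem mem_nonisolatedEdges {e : Sym2 V} :
    e ∈ G.nonisolatedEdges s ↔
      e ∈ G.inducedEdges s ∧ ∃ x ∈ e, ∃ z ∈ s, z ∉ e ∧ G.Adj x z := by
  simp [nonisolatedEdges]

theorem nonisolatedEdges_subset : G.nonisolatedEdges s ⊆ G.inducedEdges s :=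
  fun _ he => (mem_nonisolatedEdges.1 he).1

theorem inducedEdges_mono (h : t ⊆ s) : G.inducedEdges t ⊆ G.inducedEdges s := fun e he => by
  rw [mem_inducedEdges] at *
  exact ⟨he.1, fun x hx => h (he.2 x hx)⟩

theorem nonisolatedEdges_mono (h : t ⊆ s) : G.nonisolatedEdges t ⊆ G.nonisolatedEdges s := by
  intro e he
  rw [mem_nonisolatedEdges] at *
  obtain ⟨he, x, hx, z, hz, hze, hxz⟩ := he
  exact ⟨inducedEdges_mono h he, x, hx, z, h hz, hze, hxz⟩

/-- An edge that is isolated in the subgraph induced by `t` meets no other edge of it. -/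
theorem eq_of_notMem_nonisolatedEdges {e f : Sym2 V} {x : V} (he : e ∈ G.inducedEdges t)
    (he' : e ∉ G.nonisolatedEdges t) (hf : f ∈ G.inducedEdges t) (hxe : x ∈ e) (hxf : x ∈ f) :
    f = e := by
  obtain ⟨y, rfl⟩ := hxf
  by_contra hne
  rw [mk_mem_inducedEdges] at hf
  refine he' (mem_nonisolatedEdges.2 ⟨he, x, hxe, y, hf.2.2, fun hye => hne ?_, hf.1⟩)
  exact ((Sym2.mem_and_mem_iff hf.1.ne).1 ⟨hxe, hye⟩).symm

theorem card_le_inducedDegree [DecidableEq V] {R : Finset (Sym2 V)} {u : V}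
    (hR : ∀ e ∈ R, e ∈ G.inducedEdges s ∧ u ∈ e) : R.card ≤ G.inducedDegree s u := by
  classical
  refine (Finset.card_le_card fun e he => ?_).trans
    (Finset.card_image_le (s := s.filter fun z => G.Adj u z) (f := fun z => s(u, z)))
  obtain ⟨he, y, rfl⟩ := hR e he
  rw [mk_mem_inducedEdges] at he
  exact Finset.mem_image_of_mem _ (Finset.mem_filter.2 ⟨he.2.2, he.1⟩)

/-- Adding pairwise disjoint edges `e`, none of which meets the other rows, by means of a
private variable for each: the pair of an end of `e` and a vertex that lies on none of the rows. -/
theorem hasMonomialLE_union_isolated [DecidableEq V] {m : ℕ} (hm : 1 ≤ m)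
    {R₀ D₀ K : Finset (Sym2 V)} {x z : Sym2 V → V} (hd : ∀ e ∈ K, ¬e.IsDiag)
    (hx : ∀ e ∈ K, x e ∈ e)
    (hz : ∀ e ∈ K, ∀ f ∈ K ∪ R₀, z e ∉ f) (hzD : ∀ e ∈ K, ∀ f ∈ D₀, z e ∉ f)
    (hxK : ∀ e ∈ K, ∀ f ∈ K ∪ R₀, x e ∈ f → f = e) (hKR : Disjoint K R₀)
    (h : HasMonomialLE m (formProd pairRow R₀ D₀)) :
    HasMonomialLE m (formProd pairRow (K ∪ R₀) (D₀ ∪ K.image fun e => s(x e, z e))) := by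
  induction K using Finset.induction_on with
  | empty => simpa using h
  | insert e K he ih =>
    have hsub : K ∪ R₀ ⊆ insert e K ∪ R₀ :=
      Finset.union_subset_union_left (Finset.subset_insert _ _)
    have heR : e ∉ R₀ := Finset.disjoint_left.1 hKR (Finset.mem_insert_self _ _)
    have hnot : ∀ f ∈ K ∪ R₀, x e ∉ f := fun f hf hxf => by
      have := hxK e (Finset.mem_insert_self _ _) f (hsub hf) hxf
      subst this
      rcases Finset.mem_union.1 hf with h | h
      exacts [he h, heR h]
    have hmem : ∀ f ∈ K, f ∈ insert e K := fun f hf => Finset.mem_insert_of_mem hf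
    refine formProd_pairRow_of_single (R₂ := K ∪ R₀) (D := D₀ ∪ K.image fun e => s(x e, z e))
      s(x e, z e) hsub (by simp) ?_ ?_ ?_ ?_ ?_ ?_
    · exact Finset.union_subset_union_right (Finset.image_subset_image (Finset.subset_insert _ _))
    · rw [Finset.mem_union, not_or, Finset.mem_image]
      refine ⟨fun hD => hzD e (Finset.mem_insert_self _ _) _ hD (Sym2.mem_mk_right _ _), ?_⟩
      rintro ⟨f, hf, hfe⟩
      rcases Sym2.eq_iff.1 hfe with ⟨h1, -⟩ | ⟨h1, -⟩
      · exact hnot f (Finset.mem_union_left _ hf) (h1 ▸ hx f (hmem f hf))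
      · exact hz e (Finset.mem_insert_self _ _) f (hsub (Finset.mem_union_left _ hf))
          (h1 ▸ hx f (hmem f hf))
    · intro p q hpq
      have h1 := hnot _ hpq
      have h2 := hz e (Finset.mem_insert_self _ _) _ (hsub hpq)
      rw [Sym2.mem_iff, not_or] at h1 h2
      simp only [Sym2.mem_iff]
      grind
    · intro p q hpq hpq'
      have heq : s(p, q) = e := by
        simp only [Finset.mem_union, Finset.mem_insert] at hpq hpq'
        tauto
      have h1 := hx e (Finset.mem_insert_self _ _)
      have h2 := hz e (Finset.mem_insert_self _ _) _
        (Finset.mem_union_left _ (Finset.mem_insert_self e K))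
      have h3 := hd e (Finset.mem_insert_self _ _)
      generalize x e = y, z e = y' at h1 h2 ⊢
      subst heq
      rw [Sym2.mem_iff] at h1
      rw [Sym2.mem_iff, not_or] at h2
      rw [Sym2.mk_isDiag_iff] at h3
      simp only [Sym2.mem_iff]
      grind
    · refine le_trans (Finset.card_le_card (t := {e}) fun f hf => ?_) (by simpa using hm)
      simp only [Finset.mem_sdiff, Finset.mem_union, Finset.mem_insert] at hf
      simp only [Finset.mem_singleton]
      tauto
    · exact ih (fun f hf => hd f (hmem f hf)) (fun f hf => hx f (hmem f hf)) (fun f hf f' hf' => hz f (hmem f hf) f' (hsub hf'))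
        (fun f hf => hzD f (hmem f hf)) (fun f hf f' hf' => hxK f (hmem f hf) f' (hsub hf'))
        (Finset.disjoint_of_subset_left (Finset.subset_insert _ _) hKR)

/-- The induction step at two vertices `u`, `v` with a common neighbour `w`. -/
theorem hasMonomialLE_nonisolatedEdges_of_cherry [DecidableEq V] {m : ℕ} {u v w : V}
    (hu : u ∈ s) (hv : v ∈ s) (hw : w ∈ s)
    (huv : u ≠ v) (hnadj : ¬G.Adj u v) (huw : G.Adj u w) (hvw : G.Adj v w)
    (hm : G.inducedDegree s u + G.inducedDegree s v ≤ m)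
    (h : HasMonomialLE m (formProd pairRow (G.nonisolatedEdges (s \ {u, v}))
      (G.inducedEdges (s \ {u, v})))) :
    HasMonomialLE m (formProd pairRow (G.nonisolatedEdges s) (G.inducedEdges s)) := by
  classical
  set t := s \ {u, v} with ht
  have hts : t ⊆ s := Finset.sdiff_subset
  have hut : u ∉ t := by simp [ht]
  have hvt : v ∉ t := by simp [ht]
  have hmemt : ∀ {y}, y ∈ s → y ≠ u → y ≠ v → y ∈ t := fun h1 h2 h3 => by simp [ht, h1, h2, h3]
  have hdu : 1 ≤ G.inducedDegree s u :=
    Finset.card_pos.2 ⟨w, Finset.mem_filter.2 ⟨hw, huw⟩⟩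
  have hdv : 1 ≤ G.inducedDegree s v :=
    Finset.card_pos.2 ⟨w, Finset.mem_filter.2 ⟨hw, hvw⟩⟩
  have hut' : ∀ {e}, e ∈ G.inducedEdges t → u ∉ e := fun he h =>
    hut ((mem_inducedEdges.1 he).2 _ h)
  have hvt' : ∀ {e}, e ∈ G.inducedEdges t → v ∉ e := fun he h =>
    hvt ((mem_inducedEdges.1 he).2 _ h)
  have hin : ∀ {e}, e ∈ G.inducedEdges s → u ∉ e → v ∉ e → e ∈ G.inducedEdges t := by
    intro e he h1 h2
    rw [mem_inducedEdges] at he ⊢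
    exact ⟨he.1, fun x hx => hmemt (he.2 x hx) (fun h => h1 (h ▸ hx)) fun h => h2 (h ▸ hx)⟩
  -- The edges that become isolated once `u` and `v` are deleted.
  let K : Finset (Sym2 V) :=
    (G.nonisolatedEdges s).filter fun e => u ∉ e ∧ v ∉ e ∧ e ∉ G.nonisolatedEdges t
  have hK : ∀ {e}, e ∈ K ↔ e ∈ G.nonisolatedEdges s ∧ e ∈ G.inducedEdges t ∧
      e ∉ G.nonisolatedEdges t := by
    intro e
    simp only [K, Finset.mem_filter]
    exact ⟨fun h => ⟨h.1, hin (nonisolatedEdges_subset h.1) h.2.1 h.2.2.1, h.2.2.2⟩,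
      fun h => ⟨h.1, hut' h.2.1, hvt' h.2.1, h.2.2⟩⟩
  have hKex : ∀ e ∈ K, ∃ x ∈ e, ∃ z, (z = u ∨ z = v) ∧ G.Adj x z := by
    intro e he
    obtain ⟨h1, h2, h3⟩ := hK.1 he
    obtain ⟨-, x, hx, z, hz, hze, hxz⟩ := mem_nonisolatedEdges.1 h1
    refine ⟨x, hx, z, ?_, hxz⟩
    by_contra! hne
    exact h3 (mem_nonisolatedEdges.2 ⟨h2, x, hx, z, hmemt hz hne.1 hne.2, hze, hxz⟩)
  -- Those among them that can be joined to `u` or `v` by an edge other than `uw` and `vw`.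
  let K₁ : Finset (Sym2 V) := K.filter fun e => ∃ x ∈ e, ∃ z, (z = u ∨ z = v) ∧ G.Adj x z ∧ x ≠ w
  have hK₁ex : ∀ e, ∃ x z, e ∈ K₁ → x ∈ e ∧ (z = u ∨ z = v) ∧ G.Adj x z ∧ x ≠ w := by
    intro e
    by_cases he : e ∈ K₁
    · obtain ⟨x, hx, z, hz⟩ := (Finset.mem_filter.1 he).2
      exact ⟨x, z, fun _ => ⟨hx, hz⟩⟩
    · exact ⟨u, u, fun h => absurd h he⟩
  choose x z hxz using hK₁ex
  have hK₁K : K₁ ⊆ K := Finset.filter_subset _ _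
  set R₀ := K₁ ∪ G.nonisolatedEdges t with hR₀
  set D₀ := G.inducedEdges t ∪ K₁.image fun e => s(x e, z e) with hD₀
  have hR₀t : R₀ ⊆ G.inducedEdges t :=
    Finset.union_subset (fun e he => (hK.1 (hK₁K he)).2.1) nonisolatedEdges_subset
  have hR₀s : R₀ ⊆ G.nonisolatedEdges s :=
    Finset.union_subset (fun e he => (hK.1 (hK₁K he)).1) (nonisolatedEdges_mono hts)
  have hD₀s : D₀ ⊆ G.inducedEdges s := by
    refine Finset.union_subset (inducedEdges_mono hts) fun c hc => ?_
    obtain ⟨e, he, rfl⟩ := Finset.mem_image.1 hc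
    obtain ⟨h1, h2, h3, -⟩ := hxz e he
    refine mk_mem_inducedEdges.2 ⟨h3, hts ((mem_inducedEdges.1 (hK.1 (hK₁K he)).2.1).2 _ h1), ?_⟩
    rcases h2 with h2 | h2 <;> rw [h2] <;> assumption
  have hnotD₀ : ∀ y, y = u ∨ y = v → s(y, w) ∉ D₀ := by
    intro y hy hmem
    rcases Finset.mem_union.1 hmem with hmem | hmem
    · have := (mk_mem_inducedEdges.1 hmem).2.1
      rcases hy with rfl | rfl <;> contradiction
    · obtain ⟨e, he, hc⟩ := Finset.mem_image.1 hmem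
      obtain ⟨h1, h2, -, h4⟩ := hxz e he
      have hxt := (mem_inducedEdges.1 (hK.1 (hK₁K he)).2.1).2 _ h1
      rcases Sym2.eq_iff.1 hc with ⟨h5, -⟩ | ⟨h5, -⟩
      · rw [h5] at hxt
        rcases hy with rfl | rfl <;> contradiction
      · exact h4 h5
  have hndiag : ∀ e ∈ G.nonisolatedEdges s, ¬e.IsDiag := fun e he =>
    G.not_isDiag_of_mem_edgeSet (mem_inducedEdges.1 (nonisolatedEdges_subset he)).1
  have hbase : HasMonomialLE m (formProd pairRow R₀ D₀) := by
    have hzt : ∀ e ∈ K₁, ∀ f ∈ G.inducedEdges t, z e ∉ f := fun e he f hf => by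
      rcases (hxz e he).2.1 with h | h <;> rw [h]
      exacts [hut' hf, hvt' hf]
    refine hasMonomialLE_union_isolated (by omega)
      (fun e he => hndiag e (hK.1 (hK₁K he)).1) (fun e he => (hxz e he).1)
      (fun e he f hf => hzt e he f (hR₀t hf)) hzt (fun e he f hf hxf => ?_) ?_ h
    · obtain ⟨-, h2, h3⟩ := hK.1 (hK₁K he)
      exact eq_of_notMem_nonisolatedEdges h2 h3 (hR₀t hf) (hxz e he).1 hxf
    · exact Finset.disjoint_left.2 fun e he => (hK.1 (hK₁K he)).2.2
  have huwD : s(u, w) ∈ G.inducedEdges s := mk_mem_inducedEdges.2 ⟨huw, hu, hw⟩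
  have hvwD : s(v, w) ∈ G.inducedEdges s := mk_mem_inducedEdges.2 ⟨hvw, hv, hw⟩
  have hcardv : ((G.nonisolatedEdges s).filter fun e => v ∈ e).card ≤ G.inducedDegree s v :=
    card_le_inducedDegree fun e he =>
      ⟨nonisolatedEdges_subset (Finset.mem_filter.1 he).1, (Finset.mem_filter.1 he).2⟩
  by_cases hKK : K ⊆ K₁
  · refine formProd_pairRow_of_cherry huv huw.ne hvw.ne hR₀s huwD hvwD hD₀s
      (hnotD₀ u (Or.inl rfl)) (hnotD₀ v (Or.inr rfl))
      (fun e he => ⟨hut' (hR₀t he), hvt' (hR₀t he)⟩) ?_ ?_ hbase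
    · intro e he heR
      refine ⟨hndiag e he, ?_⟩
      by_contra! hne
      by_cases het : e ∈ G.nonisolatedEdges t
      · exact heR (Finset.mem_union_right _ het)
      · exact heR (Finset.mem_union_left _ (hKK (Finset.mem_filter.2 ⟨he, hne.1, hne.2, het⟩)))
    · have h1 := card_le_inducedDegree (G := G) (s := s) (u := u)
        (R := (G.nonisolatedEdges s).filter fun e => u ∈ e)
        fun e he => ⟨nonisolatedEdges_subset (Finset.mem_filter.1 he).1, (Finset.mem_filter.1 he).2⟩
      have h2 := hcardv
      refine (Finset.card_le_card fun e he => ?_).trans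
        ((Finset.card_union_le _ _).trans ((add_le_add h1 h2).trans hm))
      rw [Finset.mem_sdiff] at he
      rw [Finset.mem_union, Finset.mem_filter, Finset.mem_filter]
      by_contra! hne
      have hu' := hne.1 he.1
      have hv' := hne.2 he.1
      by_cases het : e ∈ G.nonisolatedEdges t
      · exact he.2 (Finset.mem_union_right _ het)
      · exact he.2 (Finset.mem_union_left _ (hKK (Finset.mem_filter.2 ⟨he.1, hu', hv', het⟩)))
  · -- A remaining edge `e` of `K` can be reached from `u` and `v` through `w` only.
    obtain ⟨e, he, heK₁⟩ := Finset.not_subset.1 hKK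
    have hKw : ∀ f ∈ K, f ∉ K₁ → w ∈ f := by
      intro f hf hf₁
      obtain ⟨y, hy, y', hy', hadj⟩ := hKex f hf
      by_cases hyw : y = w
      · exact hyw ▸ hy
      · exact absurd (Finset.mem_filter.2 ⟨hf, y, hy, y', hy', hadj, hyw⟩) hf₁
    have hwe := hKw e he heK₁
    obtain ⟨-, het, hent⟩ := hK.1 he
    have hwR₀ : ∀ f ∈ R₀, w ∉ f := by
      intro f hf hwf
      have := eq_of_notMem_nonisolatedEdges het hent (hR₀t hf) hwe hwf
      subst this
      rcases Finset.mem_union.1 hf with h | h <;> contradiction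
    have hRcase : ∀ f ∈ G.nonisolatedEdges s, f ∉ R₀ → u ∈ f ∨ v ∈ f ∨ w ∈ f := by
      intro f hf hfR
      by_contra! hne
      by_cases hft : f ∈ G.nonisolatedEdges t
      · exact hfR (Finset.mem_union_right _ hft)
      · have hfK : f ∈ K := Finset.mem_filter.2 ⟨hf, hne.1, hne.2.1, hft⟩
        by_cases hf₁ : f ∈ K₁
        · exact hfR (Finset.mem_union_left _ hf₁)
        · exact hne.2.2 (hKw f hfK hf₁)
    -- The rows that survive the direction of the variable of `uw`.
    let R₁ : Finset (Sym2 V) := (G.nonisolatedEdges s).filter fun f => u ∈ f ↔ w ∈ f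
    have hR₁ : HasMonomialLE m (formProd pairRow R₁ (insert s(v, w) D₀)) := by
      refine formProd_pairRow_of_single s(v, w) (R₂ := R₀) (D := D₀) ?_ (by simp) (by simp)
        (hnotD₀ v (Or.inr rfl)) ?_ ?_ ?_ hbase
      · exact fun f hf => Finset.mem_filter.2 ⟨hR₀s hf, by simp [hut' (hR₀t hf), hwR₀ f hf]⟩
      · intro p q hpq
        have h1 := hvt' (hR₀t hpq)
        have h2 := hwR₀ _ hpq
        rw [Sym2.mem_iff, not_or] at h1 h2
        simp only [Sym2.mem_iff]
        grind
      · intro p q hpq hpq'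
        obtain ⟨h1, h2⟩ := Finset.mem_filter.1 hpq
        have h3 := hRcase _ h1 hpq'
        have h4 := hndiag _ h1
        have h5 := huw.ne
        have h6 := hvw.ne
        have h7 := (mk_mem_inducedEdges.1 (nonisolatedEdges_subset h1)).1
        have h8 : ¬G.Adj v u := fun h => hnadj h.symm
        clear_value R₀ D₀ t
        simp only [Sym2.mem_iff, Sym2.mk_isDiag_iff] at h2 h3 h4 ⊢
        clear hxz hbase hKw hwR₀ hRcase
        grind
      · refine (Finset.card_le_card fun f hf => ?_).trans
          ((Finset.card_union_le _ {s(u, w)}).trans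
            ((add_le_add hcardv (Finset.card_singleton _).le).trans (by omega)))
        obtain ⟨hf₁, hf₀⟩ := Finset.mem_sdiff.1 hf
        obtain ⟨h1, h2⟩ := Finset.mem_filter.1 hf₁
        rw [Finset.mem_union, Finset.mem_filter, Finset.mem_singleton,
          ← Sym2.mem_and_mem_iff huw.ne]
        by_cases hvf : v ∈ f
        · exact Or.inl ⟨h1, hvf⟩
        by_cases huf : u ∈ f
        · exact Or.inr ⟨huf, h2.1 huf⟩
        rcases hRcase f h1 hf₀ with h | h | h
        exacts [absurd h huf, absurd h hvf, absurd (h2.2 h) huf]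
    refine formProd_pairRow_of_single s(u, w) (R₂ := R₁) (D := insert s(v, w) D₀)
      (Finset.filter_subset _ _) huwD ?_ ?_ ?_ ?_ ?_ hR₁
    · exact Finset.insert_subset hvwD hD₀s
    · rw [Finset.mem_insert, not_or]
      exact ⟨by simp [huv, huw.ne], hnotD₀ u (Or.inl rfl)⟩
    · intro p q hpq
      have h2 := (Finset.mem_filter.1 hpq).2
      have h4 := hndiag _ (Finset.mem_filter.1 hpq).1
      have h5 := huw.ne
      simp only [Sym2.mem_iff, Sym2.mk_isDiag_iff] at h2 h4 ⊢
      grind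
    · intro p q hpq hpq'
      have h2 : ¬(u ∈ s(p, q) ↔ w ∈ s(p, q)) := fun h => hpq' (Finset.mem_filter.2 ⟨hpq, h⟩)
      have h4 := hndiag _ hpq
      have h5 := huw.ne
      simp only [Sym2.mem_iff, Sym2.mk_isDiag_iff] at h2 h4 ⊢
      grind
    · have hcardu : (insert s(u, w)
          ((G.nonisolatedEdges s).filter fun f => u ∈ f ∧ w ∉ f)).card ≤ G.inducedDegree s u := by
        refine card_le_inducedDegree fun f hf => ?_
        rcases Finset.mem_insert.1 hf with rfl | hf
        · exact ⟨huwD, Sym2.mem_mk_left _ _⟩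
        · exact ⟨nonisolatedEdges_subset (Finset.mem_filter.1 hf).1, (Finset.mem_filter.1 hf).2.1⟩
      rw [Finset.card_insert_of_notMem (by simp)] at hcardu
      refine (Finset.card_le_card (t := ((G.nonisolatedEdges s).filter fun f => u ∈ f ∧ w ∉ f) ∪
        {s(v, w), e}) fun f hf => ?_).trans ((Finset.card_union_le _ _).trans
          ((add_le_add le_rfl Finset.card_le_two).trans (by omega)))
      obtain ⟨hf, hf₁⟩ := Finset.mem_sdiff.1 hf
      have h2 : ¬(u ∈ f ↔ w ∈ f) := fun h => hf₁ (Finset.mem_filter.2 ⟨hf, h⟩)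
      rw [Finset.mem_union, Finset.mem_filter, Finset.mem_insert, Finset.mem_singleton,
        ← Sym2.mem_and_mem_iff hvw.ne]
      by_cases huf : u ∈ f
      · exact Or.inl ⟨hf, huf, fun h => h2 ⟨fun _ => h, fun _ => huf⟩⟩
      · have hwf : w ∈ f := by_contra fun hwf => h2 ⟨fun h => absurd h huf, fun h => absurd h hwf⟩
        by_cases hvf : v ∈ f
        · exact Or.inr (Or.inl ⟨hvf, hwf⟩)
        · exact Or.inr (Or.inr (eq_of_notMem_nonisolatedEdges het hent
            (hin (nonisolatedEdges_subset hf) huf hvf) hwe hwf))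

/-- The induction step at a component that is a complete graph: `A` consists of a vertex `x` and
its neighbours. -/
theorem hasMonomialLE_nonisolatedEdges_of_clique [DecidableEq V] {m : ℕ} (hm : 2 ≤ m)
    {A : Finset V} (hA : A ⊆ s) (hcard : 3 ≤ A.card) (hclique : ∀ p ∈ A, ∀ q ∈ A, p ≠ q → G.Adj p q)
    (hclosed : ∀ p ∈ A, ∀ q ∈ s, G.Adj p q → q ∈ A)
    (h : HasMonomialLE m (formProd pairRow (G.nonisolatedEdges (s \ A))
      (G.inducedEdges (s \ A)))) :
    HasMonomialLE m (formProd pairRow (G.nonisolatedEdges s) (G.inducedEdges s)) := by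
  have hts : s \ A ⊆ s := Finset.sdiff_subset
  have hAE : cliquePairs A ⊆ G.inducedEdges s := fun e => Sym2.ind (fun p q hpq => by
    rw [mk_mem_cliquePairs] at hpq
    exact mk_mem_inducedEdges.2 ⟨hclique p hpq.1.1 q hpq.1.2 hpq.2, hA hpq.1.1, hA hpq.1.2⟩) e
  have hdis : ∀ {e f : Sym2 V} {x}, e ∈ G.inducedEdges (s \ A) → f ∈ cliquePairs A → x ∈ e →
      x ∉ f := by
    intro e f x he hf hxe hxf
    obtain ⟨y, rfl⟩ := hxf
    exact (Finset.mem_sdiff.1 ((mem_inducedEdges.1 he).2 x hxe)).2 (mk_mem_cliquePairs.1 hf).1.1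
  have hdisj : Disjoint (cliquePairs A) (G.inducedEdges (s \ A)) :=
    Finset.disjoint_left.2 fun e he he' => hdis he' he (Sym2.out_fst_mem e) (Sym2.out_fst_mem e)
  have hsdiff : G.nonisolatedEdges s \ G.nonisolatedEdges (s \ A) = cliquePairs A := by
    ext e
    induction e using Sym2.ind with | _ p q =>
    rw [Finset.mem_sdiff]
    constructor
    · rintro ⟨h1, h2⟩
      obtain ⟨he, x, hx, z, hz, hze, hxz⟩ := mem_nonisolatedEdges.1 h1
      have he' := mk_mem_inducedEdges.1 he
      rw [mk_mem_cliquePairs]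
      by_cases hp : p ∈ A
      · exact ⟨⟨hp, hclosed p hp q he'.2.2 he'.1⟩, he'.1.ne⟩
      by_cases hq : q ∈ A
      · exact ⟨⟨hclosed q hq p he'.2.1 he'.1.symm, hq⟩, he'.1.ne⟩
      refine absurd (mem_nonisolatedEdges.2 ⟨?_, x, hx, z, ?_, hze, hxz⟩) h2
      · simp [mk_mem_inducedEdges, he', hp, hq]
      · refine Finset.mem_sdiff.2 ⟨hz, fun hzA => ?_⟩
        rcases Sym2.mem_iff.1 hx with rfl | rfl
        · exact hp (hclosed z hzA x he'.2.1 hxz.symm)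
        · exact hq (hclosed z hzA x he'.2.2 hxz.symm)
    · intro he
      refine ⟨?_, fun h => Finset.disjoint_left.1 hdisj he (nonisolatedEdges_subset h)⟩
      have hpq := mk_mem_cliquePairs.1 he
      obtain ⟨z, hz, hz'⟩ := Finset.exists_mem_notMem_of_card_lt_card
        (s := {p, q}) (t := A) (Finset.card_le_two.trans_lt hcard)
      simp only [Finset.mem_insert, Finset.mem_singleton, not_or] at hz'
      exact mem_nonisolatedEdges.2 ⟨hAE he, p, Sym2.mem_mk_left _ _, z, hA hz,
        by simpa using hz', hclique p hpq.1.1 z hz (Ne.symm hz'.1)⟩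
  refine HasMonomialLE.formProd_of_block (R₂ := G.nonisolatedEdges (s \ A)) (T := cliquePairs A)
    (D := G.inducedEdges (s \ A)) (nonisolatedEdges_mono hts) hAE (inducedEdges_mono hts) hdisj
    ?_ ?_ h
  · intro e he c hc
    have he' := nonisolatedEdges_subset he
    simp [pairRow, incidence, hdis he' hc (Sym2.out_fst_mem e), hdis he' hc (Sym2.out_snd_mem e)]
  · rw [hsdiff]
    exact (hasMonomialLE_cliquePairs A (by omega)).mono hm

/-- If every induced subgraph with two vertices at distance two has such a pair with degree sum at
most `m`, then the edges outside the components `K₂` have a monomial with exponents at most `m`. -/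
theorem hasMonomialLE_nonisolatedEdges {m : ℕ} (hm : (∃ e, e ∈ G.edgeSet) → 2 ≤ m)
    (hdeg : ∀ s : Finset V, (∃ u ∈ s, ∃ v ∈ s, ∃ w ∈ s,
        u ≠ v ∧ ¬G.Adj u v ∧ G.Adj u w ∧ G.Adj v w) →
      ∃ u ∈ s, ∃ v ∈ s, ∃ w ∈ s, u ≠ v ∧ ¬G.Adj u v ∧ G.Adj u w ∧ G.Adj v w ∧
        G.inducedDegree s u + G.inducedDegree s v ≤ m) (s : Finset V) :
    HasMonomialLE m (formProd pairRow (G.nonisolatedEdges s) (G.inducedEdges s)) := by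
  classical
  induction s using Finset.strongInduction with | _ s ih =>
  by_cases hs : ∃ u ∈ s, ∃ v ∈ s, ∃ w ∈ s, u ≠ v ∧ ¬G.Adj u v ∧ G.Adj u w ∧ G.Adj v w
  · obtain ⟨u, hu, v, hv, w, hw, huv, hnadj, huw, hvw, hd⟩ := hdeg s hs
    exact hasMonomialLE_nonisolatedEdges_of_cherry hu hv hw huv hnadj huw hvw hd
      (ih _ (Finset.sdiff_ssubset (by simp [Finset.insert_subset_iff, hu, hv]) (by simp)))
  rcases (G.nonisolatedEdges s).eq_empty_or_nonempty with hempty | ⟨e, he⟩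
  · simpa [hempty, formProd] using HasMonomialLE.one m
  -- Without vertices at distance two, adjacency is transitive on distinct vertices.
  have htrans : ∀ a ∈ s, ∀ b ∈ s, ∀ c ∈ s, G.Adj a b → G.Adj b c → a ≠ c → G.Adj a c := by
    intro a ha b hb c hc hab hbc hac
    by_contra hnot
    exact hs ⟨a, ha, c, hc, b, hb, hac, hnot, hab, hbc.symm⟩
  obtain ⟨he, x, ⟨y, rfl⟩, z, hz, hze, hxz⟩ := mem_nonisolatedEdges.1 he
  have hxy := mk_mem_inducedEdges.1 he
  let A : Finset V := s.filter fun q => q = x ∨ G.Adj x q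
  have hxA : x ∈ A := Finset.mem_filter.2 ⟨hxy.2.1, Or.inl rfl⟩
  have hclique : ∀ p ∈ A, ∀ q ∈ A, p ≠ q → G.Adj p q := by
    intro p hp q hq hpq
    obtain ⟨hps, rfl | hp⟩ := Finset.mem_filter.1 hp <;>
      obtain ⟨hqs, rfl | hq⟩ := Finset.mem_filter.1 hq
    · exact absurd rfl hpq
    · exact hq
    · exact hp.symm
    · exact htrans p hps x hxy.2.1 q hqs hp.symm hq hpq
  refine hasMonomialLE_nonisolatedEdges_of_clique (hm ⟨_, (mem_inducedEdges.1 he).1⟩)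
    (A := A) (Finset.filter_subset _ _) ?_ hclique ?_ (ih _ ?_)
  · rw [Sym2.mem_iff, not_or] at hze
    refine le_trans (Finset.card_eq_three.2 ⟨x, y, z, hxy.1.ne, hxz.ne, Ne.symm hze.2, rfl⟩).ge
      (Finset.card_le_card fun q hq => ?_)
    simp only [Finset.mem_insert, Finset.mem_singleton] at hq
    rcases hq with rfl | rfl | rfl
    · exact hxA
    · exact Finset.mem_filter.2 ⟨hxy.2.2, Or.inr hxy.1⟩
    · exact Finset.mem_filter.2 ⟨hz, Or.inr hxz⟩
  · intro p hp q hq hpq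
    obtain ⟨hps, rfl | hp⟩ := Finset.mem_filter.1 hp
    · exact Finset.mem_filter.2 ⟨hq, Or.inr hpq⟩
    · by_cases hxq : x = q
      · exact hxq ▸ hxA
      · exact Finset.mem_filter.2 ⟨hq, Or.inr (htrans x hxy.2.1 p hps q hq hp hpq hxq)⟩
  · exact Finset.sdiff_ssubset (Finset.filter_subset _ _) ⟨x, hxA⟩

end

end SimpleGraph

namespace MvPolynomial

variable {σ ρ : Type*}

/-! ### From monomials to weightings -/

/-- The combinatorial Nullstellensatz for a product of affine forms: adding constants to the linear
forms does not change the part of top degree. -/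
theorem HasMonomialLE.exists_forall_ne_zero [Finite σ] {m : ℕ} {L : ρ → σ → ℝ} {R : Finset ρ}
    {D : Finset σ} (h : HasMonomialLE m (formProd L R D)) (b : ρ → ℝ) (S : σ → Finset ℝ)
    (hS : ∀ c, m < (S c).card) :
    ∃ x : σ → ℝ, (∀ c, x c ∈ S c) ∧ ∀ r ∈ R, b r + ∑ c ∈ D, L r c * x c ≠ 0 := by
  classical
  let f : MvPolynomial σ ℝ := ∏ r ∈ R, (C (b r) + ∑ c ∈ D, C (L r c) * X c)
  have hcoeff : (gradedSubst (fun _ => 1) id (fun _ => 1) f).coeff R.card = formProd L R D := by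
    have hrow : ∀ r, gradedSubst (fun _ => 1) id (fun _ => 1)
        (C (b r) + ∑ c ∈ D, C (L r c) * X c) =
        Polynomial.C (∑ c ∈ D, C (L r c) * X c) * Polynomial.X + Polynomial.C (C (b r)) := by
      intro r
      rw [map_add, add_comm, map_sum, map_sum, Finset.sum_mul]
      congr 1
      · refine Finset.sum_congr rfl fun c _ => ?_
        simp only [gradedSubst, map_mul, aeval_X, algHom_C, map_one, one_mul, id, pow_one,
          Polynomial.algebraMap_apply, algebraMap_eq, mul_assoc]
      · simp [gradedSubst, Polynomial.algebraMap_apply, algebraMap_eq]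
    have h1 := Polynomial.coeff_prod_of_natDegree_le R
      (fun r => gradedSubst (fun _ => 1) id (fun _ => 1) (C (b r) + ∑ c ∈ D, C (L r c) * X c)) 1
      (fun r _ => by simp only [hrow]; exact Polynomial.natDegree_linear_le)
    rw [mul_one] at h1
    rw [map_prod, h1, formProd]
    exact Finset.prod_congr rfl fun r _ => by rw [hrow]; simp
  obtain ⟨γ, hγ, hm⟩ := h
  rw [← hcoeff] at hγ
  obtain ⟨β, hβ, hβγ, hdeg⟩ := exists_mem_support_of_coeff_gradedSubst hγ
  rw [Finsupp.mapDomain_id] at hβγ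
  subst hβγ
  simp only [one_mul] at hdeg
  have htot : f.totalDegree = β.degree := by
    refine le_antisymm ?_ (le_totalDegree hβ)
    have hβR : β.degree = R.card := by rw [← hdeg, Finsupp.degree_apply]; rfl
    rw [hβR]
    refine (totalDegree_finsetProd _ _).trans ?_
    refine (Finset.sum_le_card_nsmul R _ 1 fun r _ => ?_).trans (by simp)
    refine (totalDegree_add _ _).trans (max_le (by simp) ?_)
    refine totalDegree_finsetSum_le fun c _ => ?_
    refine (totalDegree_mul _ _).trans ?_
    simp
  obtain ⟨x, hxS, hx⟩ := combinatorial_nullstellensatz_exists_eval_nonzero f β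
    (mem_support_iff.1 hβ) htot S fun c => (hm c).trans_lt (hS c)
  refine ⟨x, hxS, fun r hr h0 => hx ?_⟩
  rw [eval_prod]
  exact Finset.prod_eq_zero hr (by simpa [eval_sum] using h0)

end MvPolynomial

namespace SimpleGraph

open MvPolynomial

variable {V : Type*} {G : SimpleGraph V}

theorem degree_induce_eq_inducedDegree (s : Finset V) (v : (s : Set V))
    [Fintype ((G.induce (s : Set V)).neighborSet v)] :
    (G.induce (s : Set V)).degree v = G.inducedDegree s v := by
  classical
  rw [← card_neighborFinset_eq_degree, inducedDegree,
    ← Finset.card_map (Function.Embedding.subtype _)]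
  congr 1
  ext z
  simp [and_comm]

theorem hasPairAtDist_two_induce_iff (s : Finset V) :
    (G.induce (s : Set V)).HasPairAtDist 2 ↔ ∃ u ∈ s, ∃ v ∈ s, ∃ w ∈ s,
      u ≠ v ∧ ¬G.Adj u v ∧ G.Adj u w ∧ G.Adj v w := by
  constructor
  · rintro ⟨u, v, huv⟩
    obtain ⟨hne, hadj, w, hw⟩ := edist_eq_two_iff.1 huv
    exact ⟨u, u.2, v, v.2, w, w.2, fun h => hne (Subtype.ext h), hadj, hw.1, hw.2⟩
  · rintro ⟨u, hu, v, hv, w, hw, hne, hadj, huw, hvw⟩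
    exact ⟨⟨u, hu⟩, ⟨v, hv⟩, edist_eq_two_iff.2
      ⟨fun h => hne (congrArg Subtype.val h), hadj, ⟨w, hw⟩, huw, hvw⟩⟩

variable [Fintype V]

/-- The minimum in `δ₂(G[s])` is attained and is at most `∂₂(G)`. -/
theorem exists_inducedDegree_add_le_tDegeneracy (s : Finset V)
    (hs : ∃ u ∈ s, ∃ v ∈ s, ∃ w ∈ s, u ≠ v ∧ ¬G.Adj u v ∧ G.Adj u w ∧ G.Adj v w) :
    ∃ u ∈ s, ∃ v ∈ s, ∃ w ∈ s, u ≠ v ∧ ¬G.Adj u v ∧ G.Adj u w ∧ G.Adj v w ∧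
      G.inducedDegree s u + G.inducedDegree s v ≤ G.tDegeneracy 2 := by
  classical
  have hs' := (hasPairAtDist_two_induce_iff s).2 hs
  have hle : (G.induce (s : Set V)).minDegreeSumAtDist 2 ≤ G.tDegeneracy 2 := by
    rw [tDegeneracy, if_pos ⟨s, hs'⟩]
    exact Finset.le_sup (f := fun s : Finset V => (G.induce (s : Set V)).minDegreeSumAtDist 2)
      (Finset.mem_filter.2 ⟨Finset.mem_univ s, hs'⟩)
  obtain ⟨u₀, v₀, h₀⟩ := hs'
  obtain ⟨u, v, huv, hd⟩ := Nat.sInf_mem (s := {n : ℕ | ∃ u v : (s : Set V),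
    (G.induce (s : Set V)).edist u v = ((2 : ℕ) : ℕ∞) ∧
      n = (G.induce (s : Set V)).degree u + (G.induce (s : Set V)).degree v})
    ⟨_, u₀, v₀, h₀, rfl⟩
  obtain ⟨hne, hadj, w, hw⟩ := edist_eq_two_iff.1 huv
  refine ⟨u, u.2, v, v.2, w, w.2, fun h => hne (Subtype.ext h), hadj, hw.1, hw.2, ?_⟩
  rw [← degree_induce_eq_inducedDegree, ← degree_induce_eq_inducedDegree, ← hd]
  exact hle

/-- In a nice graph every edge meets another one, since an edge meeting no other would span a
component `K₂`. -/
theorem IsNice.nonisolatedEdges_univ (hG : G.IsNice) :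
    G.nonisolatedEdges Finset.univ = G.inducedEdges Finset.univ := by
  classical
  refine Finset.Subset.antisymm nonisolatedEdges_subset fun e => Sym2.ind (fun x y he => ?_) e
  by_contra hnot
  have hxy := (mk_mem_inducedEdges.1 he).1
  have hiso : ∀ a ∈ s(x, y), ∀ b, G.Adj a b → b ∈ s(x, y) := fun a ha b hab => by
    by_contra hb
    exact hnot (mem_nonisolatedEdges.2 ⟨he, a, ha, b, Finset.mem_univ _, hb, hab⟩)
  let c := G.connectedComponentMk x
  have hsupp : ∀ a, a ∈ c.supp ↔ a = x ∨ a = y := by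
    intro a
    rw [ConnectedComponent.mem_supp_iff, ConnectedComponent.eq, ← Sym2.mem_iff]
    constructor
    · rintro ⟨p⟩
      have key : ∀ {a b : V}, G.Walk a b → b ∈ s(x, y) → a ∈ s(x, y) := by
        intro a b p hb
        induction p with
        | nil => exact hb
        | cons hab _ ih => exact hiso _ (ih hb) _ hab.symm
      exact key p (Sym2.mem_mk_left x y)
    · intro ha
      rcases Sym2.mem_iff.1 ha with rfl | rfl
      exacts [Reachable.refl _, hxy.symm.reachable]
  have hcard : Nat.card c = 2 := by
    have : c.supp = {x, y} := Set.ext fun a => by simp [hsupp]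
    have h2 : c.supp.ncard = 2 := by rw [this, Set.ncard_pair hxy.ne]
    exact h2
  refine (hG c).elim ⟨Finite.equivFinOfCardEq hcard, fun {a b} => ?_⟩
  have hab : c.toSimpleGraph.Adj a b ↔ G.Adj a b := Iff.rfl
  rw [hab, completeGraph_eq_top, top_adj, (Finite.equivFinOfCardEq hcard).injective.ne_iff]
  constructor
  · intro hne
    have hne' : (a : V) ≠ b := fun h => hne (Subtype.ext h)
    rcases (hsupp a).1 a.2 with h1 | h1 <;> rcases (hsupp b).1 b.2 with h2 | h2
    · exact absurd (h1.trans h2.symm) hne'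
    · rw [h1, h2]; exact hxy
    · rw [h1, h2]; exact hxy.symm
    · exact absurd (h1.trans h2.symm) hne'
  · rintro h rfl
    exact h.ne rfl

theorem two_le_tDegeneracy (h : ∃ e, e ∈ G.edgeSet) :
    2 ≤ G.tDegeneracy 2 := by
  classical
  obtain ⟨e, he⟩ := h
  by_cases hs : ∃ s : Finset V, (G.induce (s : Set V)).HasPairAtDist 2
  · obtain ⟨s, hs⟩ := hs
    obtain ⟨u, hu, v, hv, w, hw, -, -, huw, hvw, hle⟩ :=
      exists_inducedDegree_add_le_tDegeneracy s ((hasPairAtDist_two_induce_iff s).1 hs)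
    have h1 : 0 < G.inducedDegree s u := Finset.card_pos.2 ⟨w, Finset.mem_filter.2 ⟨hw, huw⟩⟩
    have h2 : 0 < G.inducedDegree s v := Finset.card_pos.2 ⟨w, Finset.mem_filter.2 ⟨hw, hvw⟩⟩
    omega
  · rw [tDegeneracy, if_neg hs]
    obtain ⟨x, y⟩ := e
    have h1 : 0 < G.degree x := (G.degree_pos_iff_exists_adj x).2 ⟨y, he⟩
    have h2 := G.degree_le_maxDegree x
    omega

theorem totalWeightSum_eq (wV : V → ℝ) (x : Sym2 V → ℝ) (v : V) :
    G.totalWeightSum wV (fun e => x e) v =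
      wV v + ∑ c ∈ G.inducedEdges Finset.univ, incidence v c * x c := by
  classical
  rw [totalWeightSum, Finset.sum_filter,
    Finset.sum_subtype (p := (· ∈ G.edgeSet)) (G.inducedEdges Finset.univ)
      fun e => by simp [mem_inducedEdges]]
  congr 1
  refine Finset.sum_congr rfl fun e _ => ?_
  simp [incidence]

/-- An exponent bound for a monomial of the edge polynomial gives weight choosability. -/
theorem isWeightChoosable_of_hasMonomialLE {m : ℕ}
    (h : HasMonomialLE m (formProd pairRow (G.inducedEdges Finset.univ)
      (G.inducedEdges Finset.univ))) : G.IsWeightChoosable 1 (m + 1) := by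
  classical
  intro LV LE hLV hLE
  choose wV hwV using fun v => Finset.card_pos.1 (by rw [hLV v]; exact one_pos)
  -- The variables of non-edges are irrelevant; any set of `m + 1` reals will do for them.
  let S : Sym2 V → Finset ℝ := fun c =>
    if hc : c ∈ G.edgeSet then LE ⟨c, hc⟩ else (Finset.range (m + 1)).map Nat.castEmbedding
  have hS : ∀ c, m < (S c).card := by
    intro c
    by_cases hc : c ∈ G.edgeSet
    · simp [S, hc, hLE]
    · simp [S, hc]
  obtain ⟨x, hxS, hx⟩ := h.exists_forall_ne_zero
    (fun e => wV (Quot.out e).1 - wV (Quot.out e).2) S hS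
  refine ⟨wV, fun e => x e, hwV, fun e => ?_, fun u v huv heq => ?_⟩
  · have := hxS e
    simpa only [S, e.2, dif_pos] using this
  · rw [totalWeightSum_eq, totalWeightSum_eq] at heq
    refine hx s(u, v) (mk_mem_inducedEdges.2 ⟨huv, Finset.mem_univ _, Finset.mem_univ _⟩) ?_
    have hout : s((Quot.out s(u, v)).1, (Quot.out s(u, v)).2) = s(u, v) := Quot.out_eq _
    simp only [pairRow, sub_mul, Finset.sum_sub_distrib]
    rcases Sym2.eq_iff.1 hout with ⟨h1, h2⟩ | ⟨h1, h2⟩ <;> rw [h1, h2] <;> linarith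

end SimpleGraph

theorem mainTheorem3 {V : Type*} [Fintype V] (G : SimpleGraph V) (hG : G.IsNice) :
    G.IsWeightChoosable 1 (G.tDegeneracy 2 + 1) := by
  refine SimpleGraph.isWeightChoosable_of_hasMonomialLE ?_
  have h := SimpleGraph.hasMonomialLE_nonisolatedEdges SimpleGraph.two_le_tDegeneracy
    (SimpleGraph.exists_inducedDegree_add_le_tDegeneracy (G := G)) Finset.univ
  rwa [hG.nonisolatedEdges_univ] at h
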